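/- Let $d\ge 1$, $s>0$, $\beta>0$ and $\bar\rho>0$. For $L>0$ put $V=L^d$, $I_L=[-L/2,L/2]$, $\Lambda_L=\frac{2\pi}{L}\mathbb Z$, and consider the free Bose gas in the cube $I_L^d$ with periodic boundary conditions and one-particle Hamiltonian $h(k)=|k|^s$, $k\in\Lambda_L^d$. For $y>1$ let $$\rho_V(y)=\frac1V\sum_{k\in\Lambda_L^d}\frac{1}{y\,e^{\beta h(k)}-1}.$$ For every $L>0$ there is a unique $y_V>1$ with $\rho_V(y_V)=\bar\rho$. Let $\mu_V=-\beta^{-1}\log y_V<0$, and let $$\omega_L(A)=\frac{\operatorname{Tr}\big(e^{-\beta(d\Gamma(h)-\mu_V N)}A\big)}{\operatorname{Tr}\big(e^{-\beta(d\Gamma(h)-\mu_V N)}\big)}$$ be the grand canonical state on the bosonic Fock space over $L^2(I_L^d)\cong\ell^2(\Lambda_L^d)$. For $f\in L^2(I_L^d)$ and real $\lambda\ne0$ let $R(\lambda,f)=(i\lambda-\Phi(f))^{-1}$ be the resolvent of the self-adjoint Segal field operator, $\Phi(f)=\frac1{\sqrt2}\overline{(a^*(f)+a(f))}$. With $$b_L^{(0)}=V^{-1/2}\,1_{I_L^d},\qquad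 b_L^{(1)}=V^{-1}\,1_{I_L^d},$$ define the order parameters $$o^{(\#)}=\lim_{L\to\infty} i\,\omega_L\big(R(1,b_L^{(\#)})\big),\qquad \#=0,1,$$ and the condensate density $$\rho_0=\lim_{L\to\infty}\frac1V\,\frac1{y_V-1}.$$ Bose–Einstein condensation (BEC) is said to occur if $\rho_0>0$. Let $\rho_c=(2\pi)^{-d}\int_{\mathbb R^d}\frac{dk}{e^{\beta|k|^s}-1}\in(0,\infty]$ be the critical density. Then the limits $\rho_0$, $o^{(0)}$, $o^{(1)}$ exist, $o^{(0)},o^{(1)}\in[0,1]$, and 1. BEC occurs if and only if $o^{(1)}<1$; 2. if $\bar\rho\neq\rho_c$, then BEC occurs if and only if $o^{(0)}=0$. In particular, for $\bar\rho\ne\rho_c$ the three conditions "BEC occurs", "$o^{(0)}=0$" and "$o^{(1)}<1$" are equivalent. -/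

import Mathlib

noncomputable section

namespace FreeBose

/-! ### Bosonic Fock space in the occupation number representation -/

/-- Bosonic Fock space over `ℓ²(ι)`: square-summable functions of the occupation numbers
`n : ι →₀ ℕ`. -/
abbrev Fock (ι : Type) := lp (fun _ : ι →₀ ℕ => ℂ) 2

/-- The occupation number vector `|n⟩`; these form an orthonormal basis of Fock space. -/
def occ {ι : Type} (n : ι →₀ ℕ) : Fock ι :=
  letI := Classical.decEq (ι →₀ ℕ)
  lp.single 2 n 1

/-- `a*(f)|n⟩ = ∑ₖ fₖ √(nₖ+1) |n + δₖ⟩` for a square-summable family of mode coefficients `f`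
(an orthogonal series that converges in Fock space). -/
def creationOcc {ι : Type} (f : ι → ℂ) (n : ι →₀ ℕ) : Fock ι :=
  ∑' k : ι, (f k * (Real.sqrt (n k + 1) : ℂ)) • occ (n + Finsupp.single k 1)

/-- `a(f)|n⟩ = ∑ₖ conj(fₖ) √nₖ |n - δₖ⟩`; only the finitely many occupied modes contribute. -/
def annihilationOcc {ι : Type} (f : ι → ℂ) (n : ι →₀ ℕ) : Fock ι :=
  ∑ k ∈ n.support,
    ((starRingEnd ℂ) (f k) * (Real.sqrt (n k) : ℂ)) • occ (n - Finsupp.single k 1)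

/-- The finite linear combination `∑ₙ xₙ |n⟩`. -/
def finVec {ι : Type} : ((ι →₀ ℕ) →₀ ℂ) →ₗ[ℂ] Fock ι :=
  Finsupp.linearCombination ℂ occ

/-- The Segal field `Φ(f) = (a*(f) + a(f)) / √2` on finite linear combinations of the `|n⟩`. -/
def segalFin {ι : Type} (f : ι → ℂ) : ((ι →₀ ℕ) →₀ ℂ) →ₗ[ℂ] Fock ι :=
  Finsupp.linearCombination ℂ
    (fun n => ((Real.sqrt 2 : ℂ)⁻¹) • (creationOcc f n + annihilationOcc f n))

/-- The graph of the (self-adjoint) Segal field operator `Φ(f)`: the closure of the graph of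
its restriction to finite linear combinations of occupation number vectors. -/
def segalGraph {ι : Type} (f : ι → ℂ) : Submodule ℂ (Fock ι × Fock ι) :=
  (LinearMap.range ((finVec (ι := ι)).prod (segalFin f))).topologicalClosure

/-- `R = (i lam - Φ(f))⁻¹`: for all `φ, ψ`, `R φ = ψ` iff `ψ` lies in the domain of `Φ(f)`
and `i lam ψ - Φ(f) ψ = φ`. -/
def IsResolvent {ι : Type} (lam : ℝ) (f : ι → ℂ) (R : Fock ι →L[ℂ] Fock ι) : Prop :=
  ∀ φ ψ : Fock ι, R φ = ψ ↔ (ψ, (Complex.I * (lam : ℂ)) • ψ - φ) ∈ segalGraph f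

/-- The resolvent `R(lam, f) = (i lam - Φ(f))⁻¹` (unique by `IsResolvent`). -/
def resolvent {ι : Type} (lam : ℝ) (f : ι → ℂ) : Fock ι →L[ℂ] Fock ι :=
  Classical.epsilon (IsResolvent lam f)

/-! ### The grand canonical state -/

/-- Eigenvalue on `|n⟩` of `exp(-β (dΓ(h) - μ N))`, where the mode `k` has energy `h k`. -/
def gibbsWeight {ι : Type} (h : ι → ℝ) (β μ : ℝ) (n : ι →₀ ℕ) : ℝ :=
  Real.exp (-β * n.sum (fun k m => (m : ℝ) * (h k - μ)))

/-- The grand canonical state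
`A ↦ Tr(exp(-β (dΓ(h) - μ N)) A) / Tr(exp(-β (dΓ(h) - μ N)))`, with the traces computed in the
eigenbasis `|n⟩`. -/
def gibbsState {ι : Type} (h : ι → ℝ) (β μ : ℝ) (A : Fock ι →L[ℂ] Fock ι) : ℂ :=
  (∑' n : ι →₀ ℕ, (gibbsWeight h β μ n : ℂ) * inner ℂ (occ n) (A (occ n))) /
    (∑' n : ι →₀ ℕ, (gibbsWeight h β μ n : ℂ))

/-! ### The free Bose gas in the box `[-L/2, L/2]^d` -/

/-- The momentum `2π m / L` of the mode with integer label `m`. -/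
def momentum (d : ℕ) (L : ℝ) (m : Fin d → ℤ) : EuclideanSpace ℝ (Fin d) :=
  WithLp.toLp 2 (fun i => 2 * Real.pi / L * (m i : ℝ))

/-- The one-particle Hamiltonian `|k|^s`. -/
def dispersion (d : ℕ) (s : ℝ) (k : EuclideanSpace ℝ (Fin d)) : ℝ := ‖k‖ ^ s

/-- One-particle energies on the momentum lattice `(2π/L) ℤ^d`. -/
def energy (d : ℕ) (s L : ℝ) (m : Fin d → ℤ) : ℝ := dispersion d s (momentum d L m)

/-- The cube `[-L/2, L/2]^d`. -/
def box (d : ℕ) (L : ℝ) : Set (Fin d → ℝ) := Set.univ.pi (fun _ => Set.Icc (-(L / 2)) (L / 2))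

/-- Coefficients of a function on the cube in the orthonormal basis `L^(-d/2) exp(i k·x)`,
`k ∈ (2π/L) ℤ^d`. -/
def modeCoeff (d : ℕ) (L : ℝ) (f : (Fin d → ℝ) → ℂ) (m : Fin d → ℤ) : ℂ :=
  (((L ^ d) ^ (-(1 / 2) : ℝ) : ℝ) : ℂ) *
    ∫ x in box d L, Complex.exp (-Complex.I * ((∑ i, momentum d L m i * x i : ℝ) : ℂ)) * f x

/-- The normalized indicator function `V^(-(1+a)/2) 1_[-L/2,L/2]^d`, with `V = L^d`; it is used
for `a = 0` and `a = 1`. -/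
def boxFun (d : ℕ) (L : ℝ) (a : ℝ) : (Fin d → ℝ) → ℂ :=
  (box d L).indicator (fun _ => (((L ^ d) ^ (-((1 + a) / 2)) : ℝ) : ℂ))

/-- Particle density `V⁻¹ ∑ₖ 1 / (y exp(β |k|^s) - 1)` in the cube. -/
def density (d : ℕ) (s β L y : ℝ) : ℝ :=
  (∑' m : Fin d → ℤ, 1 / (y * Real.exp (β * energy d s L m) - 1)) / L ^ d

/-- The value `y > 1` of `exp(-β μ)` for which the density in the cube is `ρ`. -/
def yBox (d : ℕ) (s β ρ L : ℝ) : ℝ :=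
  Function.invFunOn (density d s β L) (Set.Ioi 1) ρ

/-- The chemical potential at which the density in the cube is `ρ`, from `y = exp(-β μ)`. -/
def chemPot (d : ℕ) (s β ρ L : ℝ) : ℝ := -Real.log (yBox d s β ρ L) / β

/-- Occupation per volume `V⁻¹ / (y - 1)` of the zero mode at density `ρ`. -/
def zeroModeDensity (d : ℕ) (s β ρ L : ℝ) : ℝ := (1 / (yBox d s β ρ L - 1)) / L ^ d

/-- `ρ₀` is the condensate density: the infinite volume limit of the occupation per volume of
the zero mode at fixed density `ρ`. -/
def IsCondensateDensity (d : ℕ) (s β ρ ρ₀ : ℝ) : Prop :=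
  Filter.Tendsto (zeroModeDensity d s β ρ) Filter.atTop (nhds ρ₀)

/-- The critical density `(2π)^(-d) ∫ dk / (exp(β |k|^s) - 1)`, possibly infinite. -/
def criticalDensity (d : ℕ) (s β : ℝ) : ENNReal :=
  ENNReal.ofReal (((2 * Real.pi) ^ d)⁻¹) *
    ∫⁻ k : EuclideanSpace ℝ (Fin d),
      ENNReal.ofReal (1 / (Real.exp (β * dispersion d s k) - 1))

/-- `i ω_L(R(1, b_L))`, where `ω_L` is the grand canonical state of the free gas with density
`ρ` in the cube and `b_L` is the normalized indicator function `boxFun d L a`. -/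
def boxOrder (d : ℕ) (s β ρ a L : ℝ) : ℂ :=
  Complex.I * gibbsState (energy d s L) β (chemPot d s β ρ L)
    (resolvent 1 (modeCoeff d L (boxFun d L a)))

/-- `o` is the order parameter `lim_{L → ∞} i ω_L(R(1, b_L))`. -/
def IsOrderParameter (d : ℕ) (s β ρ a o : ℝ) : Prop :=
  Filter.Tendsto (boxOrder d s β ρ a) Filter.atTop (nhds (o : ℂ))

end FreeBose

end

/-! The indicator of the box is constant, so only the mode `k = 0` enters (`modeCoeff_boxFun`): with
`c = V^(-a/2)`, the field is `c/√2` times the sum of the creation and annihilation operators of that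
mode. In occupation numbers this is a Jacobi matrix with entries `(c/√2) √(n+1)`, which is the
matrix of multiplication by `(c/√2) x` in the normalized Hermite basis `h_n` of `L²(γ)`, `γ`
standard Gaussian. The Jacobi recurrence at `i` has no nonzero square-summable solution
(`eq_zero_of_jacobi_of_summable`). This gives both the existence of the resolvent and its diagonal
elements `∫ h_n² / (i - c x/√2) dγ` (`inner_occ_resolvent`).

In the Gibbs state the occupation of the zero mode is geometric with ratio `q = 1/y_V`, and the
mixture `(1-q) ∑ qⁿ h_n² γ` is a centred Gaussian of variance `(1+q)/(1-q)`
(`thermalMeasure_eq_gaussianReal`, a form of Mehler's formula). Hence (`boxOrder_eq`) `i ω_L(R(1,b))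
= G(V^(-a) (1/2 + 1/(y_V - 1)))`, where `G(v) = E[1/(1 + v X²)]` is `gaussianLorentz`. This `G` is
continuous on `[0,∞)`, with `G(0) = 1`, `0 < G(v) < 1` for `v > 0`, and `G(v) → 0` as `v → ∞`.

It remains to find the limit of `y_V`. The density of the nonzero modes is a Riemann sum for the
infinite-volume integral and converges to it, even as `y → 1` if `ρ_c` is finite
(`tendsto_latticeBose_div_volume`). If `ρ < ρ_c`, then `y_V → y > 1`, so `ρ₀ = 0`, `o₁ = 1` and `o₀
= G(1/2 + 1/(y-1)) > 0`. If `ρ ≥ ρ_c`, then `y_V → 1`, the zero mode carries the rest `ρ₀ = ρ -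
ρ_c`, `o₁ = G(ρ₀)`, and `o₀ = 0` because `1/(y_V - 1) → ∞`. At `ρ = ρ_c` both `o₀` and `ρ₀` vanish,
which is why the second equivalence excludes this value. -/

open MeasureTheory ProbabilityTheory Filter Topology

namespace FreeBose

/-! ### Normalized Hermite polynomials and the standard Gaussian measure -/

/-- The standard Gaussian measure on the line. -/
noncomputable abbrev stdGaussianReal : Measure ℝ := gaussianReal 0 1

lemma integrable_eval_stdGaussianReal (p : Polynomial ℝ) :
    Integrable (fun x => p.eval x) stdGaussianReal := by
  simp only [Polynomial.eval_eq_sum_range]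
  refine integrable_finsetSum _ fun n _ => Integrable.const_mul ?_ _
  have h := (memLp_id_gaussianReal (μ := 0) (v := 1) n).integrable_norm_pow'
  refine h.mono (by fun_prop) (Eventually.of_forall fun x => ?_)
  simp

lemma integrable_eval_mul_stdGaussianReal (p : Polynomial ℝ) {f : ℝ → ℂ} (hf : Continuous f)
    {C : ℝ} (hC : ∀ x, ‖f x‖ ≤ C) :
    Integrable (fun x => ((p.eval x : ℝ) : ℂ) * f x) stdGaussianReal := by
  refine (integrable_eval_stdGaussianReal p).ofReal.mul_bdd
    hf.aestronglyMeasurable (Eventually.of_forall hC)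

lemma integrable_eval_mul_exp (p : Polynomial ℝ) (t : ℝ) :
    Integrable (fun x : ℝ => ((p.eval x : ℝ) : ℂ) * Complex.exp (t * x * Complex.I))
      stdGaussianReal := by
  refine integrable_eval_mul_stdGaussianReal p (by fun_prop) (C := 1) fun x => ?_
  rw [← Complex.ofReal_mul, Complex.norm_exp_ofReal_mul_I]

lemma hasDerivAt_gaussianPDFReal (x : ℝ) :
    HasDerivAt (gaussianPDFReal 0 1) (-x * gaussianPDFReal 0 1 x) x := by
  unfold gaussianPDFReal
  have h : HasDerivAt (fun x : ℝ => -(x - 0) ^ 2 / (2 * ((1 : NNReal) : ℝ))) (-x) x := by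
    have := (((hasDerivAt_id' x).sub_const 0).pow 2).neg.div_const (2 * ((1 : NNReal) : ℝ))
    refine this.congr_deriv ?_
    simp
    ring
  refine (h.exp.const_mul ((√(2 * Real.pi * ((1 : NNReal) : ℝ)))⁻¹)).congr_deriv ?_
  ring

/-- Gaussian integration by parts. -/
lemma integral_mul_eval_mul_exp (p : Polynomial ℝ) (t : ℝ) :
    ∫ x : ℝ, (x : ℂ) * ((p.eval x : ℝ) : ℂ) * Complex.exp (t * x * Complex.I) ∂stdGaussianReal
      = (∫ x : ℝ, ((p.derivative.eval x : ℝ) : ℂ) * Complex.exp (t * x * Complex.I) ∂stdGaussianReal)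
        + t * Complex.I *
          ∫ x : ℝ, ((p.eval x : ℝ) : ℂ) * Complex.exp (t * x * Complex.I) ∂stdGaussianReal := by
  have key : ∀ q : Polynomial ℝ, Integrable (fun x : ℝ => (gaussianPDFReal 0 1 x : ℂ) *
      (((q.eval x : ℝ) : ℂ) * Complex.exp (t * x * Complex.I))) := by
    intro q
    have h := integrable_eval_mul_exp q t
    rw [stdGaussianReal, gaussianReal_of_var_ne_zero _ one_ne_zero,
      integrable_withDensity_iff_integrable_smul' (measurable_gaussianPDF _ _)
        (Eventually.of_forall fun x => gaussianPDF_lt_top)] at h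
    refine h.congr (Eventually.of_forall fun x => ?_)
    simp [toReal_gaussianPDF]
  have hp := key p
  have hp' := key (Polynomial.derivative p)
  have hxp := key (Polynomial.X * p)
  -- The derivative of density times `p(x) e^{itx}` integrates to zero over the line; the term from
  -- `φ' = -x φ` is the left-hand side of the claim.
  have hd : ∀ x : ℝ, HasDerivAt (fun x : ℝ => (gaussianPDFReal 0 1 x : ℂ) *
      (((p.eval x : ℝ) : ℂ) * Complex.exp (t * x * Complex.I)))
      ((gaussianPDFReal 0 1 x : ℂ) *
        (((p.derivative.eval x : ℝ) : ℂ) * Complex.exp (t * x * Complex.I))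
       + t * Complex.I * ((gaussianPDFReal 0 1 x : ℂ) *
          (((p.eval x : ℝ) : ℂ) * Complex.exp (t * x * Complex.I)))
       - (gaussianPDFReal 0 1 x : ℂ) *
        ((((Polynomial.X * p).eval x : ℝ) : ℂ) * Complex.exp (t * x * Complex.I))) x := by
    intro x
    have h1 := (hasDerivAt_gaussianPDFReal x).ofReal_comp
    have h2 := (p.hasDerivAt x).ofReal_comp
    have h3 : HasDerivAt (fun x : ℝ => Complex.exp (t * x * Complex.I))
        (Complex.exp (t * x * Complex.I) * (t * 1 * Complex.I)) x :=
      (((hasDerivAt_id x).ofReal_comp.const_mul (t : ℂ)).mul_const Complex.I).cexp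
    refine (h1.mul (h2.mul h3)).congr_deriv ?_
    simp
    ring
  have h0 := integral_eq_zero_of_hasDerivAt_of_integrable hd
    ((hp'.add (hp.const_mul _)).sub hxp) hp
  have hs := hp'.add (hp.const_mul (t * Complex.I))
  simp only [Pi.add_def] at hs
  rw [integral_sub hs hxp, integral_add hp' (hp.const_mul _),
    integral_const_mul, sub_eq_zero] at h0
  simp only [stdGaussianReal]
  rw [integral_gaussianReal_eq_integral_smul one_ne_zero,
    integral_gaussianReal_eq_integral_smul one_ne_zero,
    integral_gaussianReal_eq_integral_smul one_ne_zero]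
  simp only [Complex.real_smul]
  rw [h0]
  simp

/-- The Hermite polynomials, normalized in `L²` of the standard Gaussian measure. -/
noncomputable def hermiteNormed : ℕ → Polynomial ℝ
  | 0 => 1
  | 1 => Polynomial.X
  | n + 2 => Polynomial.C (√(n + 2 : ℝ))⁻¹ *
      (Polynomial.X * hermiteNormed (n + 1) - Polynomial.C √(n + 1 : ℝ) * hermiteNormed n)

-- This is the matrix of `a + a*` in occupation numbers, so multiplication by `x` models the field
-- of one mode. For `n = 0` the truncated index `n - 1` is harmless because its coefficient is `√0`.
open Polynomial in
lemma X_mul_hermiteNormed (n : ℕ) :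
    X * hermiteNormed n = C √(n + 1 : ℝ) * hermiteNormed (n + 1)
      + C √(n : ℝ) * hermiteNormed (n - 1) := by
  cases n with
  | zero => simp [hermiteNormed]
  | succ n =>
    have h : √((n : ℝ) + 1 + 1) ≠ 0 := by positivity
    have h2 : ((n : ℝ) + 2) = n + 1 + 1 := by ring
    simp only [Nat.add_sub_cancel, Nat.cast_add, Nat.cast_one, hermiteNormed]
    rw [← mul_assoc, ← C_mul, h2, mul_inv_cancel₀ h]
    simp

-- Differentiation is the annihilation operator in the Hermite basis; with integration by parts it
-- yields orthonormality.
open Polynomial in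
lemma derivative_hermiteNormed (n : ℕ) :
    derivative (hermiteNormed n) = C √(n : ℝ) * hermiteNormed (n - 1) := by
  induction n using Nat.twoStepInduction with
  | zero => simp [hermiteNormed]
  | one => simp [hermiteNormed]
  | more n ih1 ih2 =>
    have h1 : √((n : ℝ) + 1) * √((n : ℝ) + 1) = n + 1 := Real.mul_self_sqrt (by positivity)
    have e := X_mul_hermiteNormed n
    have e' : X * hermiteNormed n - C √(n : ℝ) * hermiteNormed (n - 1)
      = C √(n + 1 : ℝ) * hermiteNormed (n + 1) := by rw [e]; ring
    rw [hermiteNormed]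
    simp only [derivative_mul, derivative_C, zero_mul, zero_add, map_sub, derivative_X, one_mul,
      ih1, ih2]
    simp only [Nat.add_sub_cancel, Nat.cast_add, Nat.cast_one, Nat.cast_ofNat]
    have : hermiteNormed (n + 1) + X * (C √((n : ℝ) + 1) * hermiteNormed n)
        - C √((n : ℝ) + 1) * (C √(n : ℝ) * hermiteNormed (n - 1))
        = C (n + 2 : ℝ) * hermiteNormed (n + 1) := by
      calc _ = hermiteNormed (n + 1) + C √((n : ℝ) + 1) *
            (X * hermiteNormed n - C √(n : ℝ) * hermiteNormed (n - 1)) := by ring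
        _ = (1 + C (√((n : ℝ) + 1) * √((n : ℝ) + 1))) * hermiteNormed (n + 1) := by
            rw [e', C_mul]; ring
        _ = _ := by rw [h1, ← C_1, ← C_add]; congr 2; ring
    have e2 : n + 2 - 1 = n + 1 := rfl
    have e3 : (√((n : ℝ) + 2))⁻¹ * (n + 2) = √((n : ℝ) + 2) := by
      rw [inv_mul_eq_div, Real.div_sqrt]
    rw [this, ← mul_assoc, ← C_mul, e2, e3]

lemma mul_eval_hermiteNormed (n : ℕ) (x : ℝ) :
    x * (hermiteNormed n).eval x = √(n + 1 : ℝ) * (hermiteNormed (n + 1)).eval x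
      + √(n : ℝ) * (hermiteNormed (n - 1)).eval x := by
  simpa using congrArg (Polynomial.eval x) (X_mul_hermiteNormed n)

lemma integral_mul_eval (p : Polynomial ℝ) :
    ∫ x : ℝ, x * p.eval x ∂stdGaussianReal = ∫ x, p.derivative.eval x ∂stdGaussianReal := by
  have h := integral_mul_eval_mul_exp p 0
  simp only [Complex.ofReal_zero, zero_mul, Complex.exp_zero, mul_one, add_zero,
    ← Complex.ofReal_mul, integral_complex_ofReal] at h
  exact_mod_cast h

/-- `√(n+1) h_{n+1} = x h_n - h_n'`, and `x - d/dx` is the adjoint of `d/dx` in `L²(γ)`. -/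
lemma integral_hermiteNormed_succ_mul (n : ℕ) (p : Polynomial ℝ) :
    √(n + 1 : ℝ) * ∫ x, (hermiteNormed (n + 1)).eval x * p.eval x ∂stdGaussianReal
      = ∫ x, (hermiteNormed n).eval x * p.derivative.eval x ∂stdGaussianReal := by
  have h := integral_mul_eval (hermiteNormed n * p)
  have hi : ∀ p q : Polynomial ℝ, Integrable (fun x => p.eval x * q.eval x) stdGaussianReal := by
    intro p q
    simpa using integrable_eval_stdGaussianReal (p * q)
  rw [← integral_const_mul]
  have e : ∀ x : ℝ, √(n + 1 : ℝ) * ((hermiteNormed (n + 1)).eval x * p.eval x)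
      = x * (hermiteNormed n * p).eval x
        - (Polynomial.derivative (hermiteNormed n)).eval x * p.eval x := by
    intro x
    have := mul_eval_hermiteNormed n x
    simp only [Polynomial.eval_mul, derivative_hermiteNormed, Polynomial.eval_C]
    linear_combination (-p.eval x) * this
  simp only [e]
  have hx : Integrable (fun x : ℝ => x * (hermiteNormed n * p).eval x) stdGaussianReal := by
    simpa using hi Polynomial.X (hermiteNormed n * p)
  rw [integral_sub hx (hi _ _), h]
  simp only [Polynomial.derivative_mul, Polynomial.eval_add, Polynomial.eval_mul]
  rw [integral_add (hi _ _) (hi _ _)]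
  ring

lemma integral_hermiteNormed_mul (m n : ℕ) :
    ∫ x, (hermiteNormed m).eval x * (hermiteNormed n).eval x ∂stdGaussianReal
      = if m = n then 1 else 0 := by
  induction m generalizing n with
  | zero =>
    cases n with
    | zero => simp [hermiteNormed]
    | succ n =>
      have h := integral_hermiteNormed_succ_mul n 1
      have h0 : √(n + 1 : ℝ) ≠ 0 := by positivity
      simp [h0] at h
      simp [hermiteNormed, h]
  | succ m ih =>
    have h := integral_hermiteNormed_succ_mul m (hermiteNormed n)
    have h0 : √(m + 1 : ℝ) ≠ 0 := by positivity
    have e : ∀ x, (hermiteNormed m).eval x * (Polynomial.derivative (hermiteNormed n)).eval x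
        = √(n : ℝ) * ((hermiteNormed m).eval x * (hermiteNormed (n - 1)).eval x) := by
      intro x
      simp only [derivative_hermiteNormed, Polynomial.eval_mul, Polynomial.eval_C]
      ring
    simp only [e] at h
    rw [integral_const_mul, ih] at h
    cases n with
    | zero => simpa [h0] using h
    | succ n =>
      by_cases hmn : m = n
      · subst hmn
        simp only [Nat.cast_add, Nat.cast_one, Nat.add_sub_cancel, if_true, mul_one] at h
        simpa [h0] using h
      · simpa [h0, hmn] using h

/-! ### The position distribution of a thermal mode -/

/-- The measure `(1 - q) ∑ₙ qⁿ hₙ² γ`, with `γ` the standard Gaussian measure: the distribution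
of the normalized field of one mode in the state with weights proportional to `qⁿ`. -/
noncomputable def thermalMeasure (q : ℝ) : Measure ℝ :=
  Measure.sum fun n : ℕ => stdGaussianReal.withDensity
    fun x => ENNReal.ofReal ((1 - q) * q ^ n * (hermiteNormed n).eval x ^ 2)

lemma measurable_hermiteNormed_density (a : ℝ) (n : ℕ) :
    Measurable fun x : ℝ => ENNReal.ofReal (a * (hermiteNormed n).eval x ^ 2) := by
  have : Continuous fun x : ℝ => a * (hermiteNormed n).eval x ^ 2 := by fun_prop
  exact this.measurable.ennreal_ofReal

lemma integral_withDensity_hermiteNormed {E : Type*} [NormedAddCommGroup E] [NormedSpace ℝ E]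
    {a : ℝ} (ha : 0 ≤ a) (n : ℕ) (f : ℝ → E) :
    ∫ x, f x ∂(stdGaussianReal.withDensity
      fun x => ENNReal.ofReal (a * (hermiteNormed n).eval x ^ 2))
      = a • ∫ x, (hermiteNormed n).eval x ^ 2 • f x ∂stdGaussianReal := by
  rw [integral_withDensity_eq_integral_toReal_smul (measurable_hermiteNormed_density a n)
    (Eventually.of_forall fun x => ENNReal.ofReal_lt_top), ← integral_smul]
  refine integral_congr_ae (Eventually.of_forall fun x => ?_)
  simp only [smul_smul]
  rw [ENNReal.toReal_ofReal (by positivity)]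

lemma integrable_withDensity_hermiteNormed {E : Type*} [NormedAddCommGroup E] [NormedSpace ℝ E]
    {a : ℝ} (ha : 0 ≤ a) (n : ℕ) {f : ℝ → E}
    (hf : Integrable (fun x => (hermiteNormed n).eval x ^ 2 • f x) stdGaussianReal) :
    Integrable f (stdGaussianReal.withDensity
      fun x => ENNReal.ofReal (a * (hermiteNormed n).eval x ^ 2)) := by
  rw [integrable_withDensity_iff_integrable_smul' (measurable_hermiteNormed_density a n)
    (Eventually.of_forall fun x => ENNReal.ofReal_lt_top)]
  refine (hf.smul a).congr (Eventually.of_forall fun x => ?_)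
  simp only [Pi.smul_apply, smul_smul]
  rw [ENNReal.toReal_ofReal (by positivity)]

lemma integral_hermiteNormed_sq (n : ℕ) :
    ∫ x, (hermiteNormed n).eval x ^ 2 ∂stdGaussianReal = 1 := by
  simpa [sq] using integral_hermiteNormed_mul n n

lemma integral_sq_mul_hermiteNormed_sq (n : ℕ) :
    ∫ x, x ^ 2 * (hermiteNormed n).eval x ^ 2 ∂stdGaussianReal = 2 * n + 1 := by
  have e : ∀ x : ℝ, x ^ 2 * (hermiteNormed n).eval x ^ 2
      = (n + 1) * (hermiteNormed (n + 1)).eval x ^ 2 + n * (hermiteNormed (n - 1)).eval x ^ 2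
        + 2 * √(n + 1 : ℝ) * √(n : ℝ) *
          ((hermiteNormed (n + 1)).eval x * (hermiteNormed (n - 1)).eval x) := by
    intro x
    have h1 : √((n : ℝ) + 1) ^ 2 = n + 1 := Real.sq_sqrt (by positivity)
    have h2 : √(n : ℝ) ^ 2 = n := Real.sq_sqrt (by positivity)
    rw [← mul_pow, mul_eval_hermiteNormed, add_sq, mul_pow, mul_pow, h1, h2]
    ring
  have hi : ∀ p q : Polynomial ℝ, Integrable (fun x => p.eval x * q.eval x) stdGaussianReal := by
    intro p q
    simpa using integrable_eval_stdGaussianReal (p * q)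
  have hs : ∀ p : Polynomial ℝ, Integrable (fun x => p.eval x ^ 2) stdGaussianReal := by
    intro p
    simpa [sq] using hi p p
  simp only [e]
  rw [integral_add (by exact ((hs _).const_mul _).add ((hs _).const_mul _))
    ((hi _ _).const_mul _), integral_add ((hs _).const_mul _) ((hs _).const_mul _), integral_const_mul,
    integral_const_mul, integral_const_mul, integral_hermiteNormed_sq, integral_hermiteNormed_sq,
    integral_hermiteNormed_mul, if_neg (by omega)]
  ring

/-- The second moment of `h_n² γ` is `2n+1`, and this linear growth is beaten by `qⁿ`. Quadratic
growth of `f` is allowed so that `x e^{itx}` can be integrated too. -/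
lemma integrable_sum_thermal {q : ℝ} (hq : 0 ≤ q) (hq1 : q < 1) {E : Type*}
    [NormedAddCommGroup E] [NormedSpace ℝ E] {f : ℝ → E} (hf : Continuous f) {C : ℝ}
    (hC : ∀ x, ‖f x‖ ≤ C * (1 + x ^ 2)) :
    Integrable f (thermalMeasure q) := by
  have hp : ∀ n : ℕ, Integrable (fun x => C * ((hermiteNormed n).eval x ^ 2
      + x ^ 2 * (hermiteNormed n).eval x ^ 2)) stdGaussianReal := by
    intro n
    have := (integrable_eval_stdGaussianReal (hermiteNormed n ^ 2
      + Polynomial.X ^ 2 * hermiteNormed n ^ 2)).const_mul C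
    simpa only [Polynomial.eval_add, Polynomial.eval_mul, Polynomial.eval_pow, Polynomial.eval_X]
      using this
  have hb : ∀ (n : ℕ) (x : ℝ), ‖(hermiteNormed n).eval x ^ 2 • f x‖
      ≤ C * ((hermiteNormed n).eval x ^ 2 + x ^ 2 * (hermiteNormed n).eval x ^ 2) := by
    intro n x
    rw [norm_smul, Real.norm_of_nonneg (sq_nonneg _)]
    refine (mul_le_mul_of_nonneg_left (hC x) (sq_nonneg _)).trans_eq ?_
    ring
  have hfi : ∀ n : ℕ, Integrable (fun x => (hermiteNormed n).eval x ^ 2 • f x)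
      stdGaussianReal := fun n =>
    (hp n).mono' (Continuous.aestronglyMeasurable (by fun_prop)) (Eventually.of_forall (hb n))
  have h0 : ∀ n, 0 ≤ (1 - q) * q ^ n := fun n => mul_nonneg (by linarith) (pow_nonneg hq n)
  refine integrable_sum_measure (fun n => integrable_withDensity_hermiteNormed (h0 n) n (hfi n)) ?_
  have hsum : Summable fun n : ℕ => (1 - q) * q ^ n * (C * (2 * n + 2)) := by
    have h1 := summable_pow_mul_geometric_of_norm_lt_one 1 (r := q)
      (by rwa [Real.norm_of_nonneg hq])
    have h2 := summable_geometric_of_lt_one hq hq1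
    refine ((h1.mul_left (2 * C * (1 - q))).add (h2.mul_left (2 * C * (1 - q)))).congr fun n => ?_
    ring
  refine Summable.of_nonneg_of_le (fun n => integral_nonneg fun x => norm_nonneg _)
    (fun n => ?_) hsum
  rw [integral_withDensity_hermiteNormed (h0 n)]
  refine mul_le_mul_of_nonneg_left ?_ (h0 n)
  have h2 : ∫ x, C * ((hermiteNormed n).eval x ^ 2 + x ^ 2 * (hermiteNormed n).eval x ^ 2)
      ∂stdGaussianReal = C * (2 * n + 2) := by
    rw [integral_const_mul, integral_add, integral_hermiteNormed_sq,
      integral_sq_mul_hermiteNormed_sq]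
    · ring
    · have := integrable_eval_stdGaussianReal (hermiteNormed n ^ 2)
      simpa only [Polynomial.eval_pow] using this
    · have := integrable_eval_stdGaussianReal (Polynomial.X ^ 2 * hermiteNormed n ^ 2)
      simpa only [Polynomial.eval_mul, Polynomial.eval_pow, Polynomial.eval_X] using this
  rw [← h2]
  refine integral_mono_of_nonneg (Eventually.of_forall fun x => by positivity) (hp n)
    (Eventually.of_forall fun x => ?_)
  have := hb n x
  rwa [norm_smul, Real.norm_of_nonneg (sq_nonneg _)] at this

lemma hasSum_integral_thermalMeasure {q : ℝ} (hq : 0 ≤ q) (hq1 : q < 1) {E : Type*}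
    [NormedAddCommGroup E] [NormedSpace ℝ E] {f : ℝ → E} (hf : Continuous f) {C : ℝ}
    (hC : ∀ x, ‖f x‖ ≤ C * (1 + x ^ 2)) :
    HasSum (fun n : ℕ => ((1 - q) * q ^ n) •
      ∫ x, (hermiteNormed n).eval x ^ 2 • f x ∂stdGaussianReal) (∫ x, f x ∂thermalMeasure q) := by
  have h := hasSum_integral_measure (integrable_sum_thermal hq hq1 hf hC)
  refine HasSum.congr_fun h fun n => Eq.symm ?_
  exact integral_withDensity_hermiteNormed (mul_nonneg (by linarith) (pow_nonneg hq n)) n f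

lemma isProbabilityMeasure_thermalMeasure {q : ℝ} (hq : 0 ≤ q) (hq1 : q < 1) :
    IsProbabilityMeasure (thermalMeasure q) := by
  have hb : ∀ x : ℝ, ‖(1 : ℝ)‖ ≤ 1 * (1 + x ^ 2) := fun x => by
    simpa using sq_nonneg x
  have hi := integrable_sum_thermal hq hq1 (continuous_const (y := (1 : ℝ))) hb
  have h := hasSum_integral_thermalMeasure hq hq1 (continuous_const (y := (1 : ℝ))) hb
  simp only [smul_eq_mul, mul_one, integral_hermiteNormed_sq] at h
  have h2 := (hasSum_geometric_of_lt_one hq hq1).mul_left (1 - q)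
  rw [mul_inv_cancel₀ (by linarith)] at h2
  have h3 := h.unique h2
  have hfin : IsFiniteMeasure (thermalMeasure q) := by
    simpa [integrable_const_iff] using hi
  rw [integral_const, smul_eq_mul, mul_one] at h3
  exact isProbabilityMeasure_iff_real.2 h3

/-- Differential equation for the characteristic function. With `J n = √n ∫ h_n h_{n-1} e^{itx} dγ`,
the integral of `x h_n² e^{itx}` is `J (n+1) + J n` by the recurrence and `2 J n + it ∫ h_n²
e^{itx}` by parts. Summed with weights `(1-q) qⁿ`, these express `∑ qⁿ J n` and `∑ qⁿ J (n+1)`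
through `A` and `D`; since `J 0 = 0`, the first sum is `q` times the second, and the resulting
equation is solved for `D`. -/
lemma integral_id_mul_exp_thermalMeasure {q : ℝ} (hq : 0 ≤ q) (hq1 : q < 1) (t : ℝ) :
    ∫ x : ℝ, (x : ℂ) * Complex.exp (t * x * Complex.I) ∂thermalMeasure q
      = ((1 + q) / (1 - q) : ℝ) * (t * Complex.I) *
        ∫ x : ℝ, Complex.exp (t * x * Complex.I) ∂thermalMeasure q := by
  have hn : ∀ x : ℝ, ‖Complex.exp (t * x * Complex.I)‖ = 1 := fun x => by
    rw [← Complex.ofReal_mul, Complex.norm_exp_ofReal_mul_I]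
  let e : ℝ → ℂ := fun x => Complex.exp (t * x * Complex.I)
  have hA := hasSum_integral_thermalMeasure hq hq1 (f := e) (C := 1) (by fun_prop)
    (fun x => by rw [hn]; nlinarith [sq_nonneg x])
  have hD := hasSum_integral_thermalMeasure hq hq1
    (f := fun x : ℝ => (x : ℂ) * e x) (C := 1) (by fun_prop)
    (fun x => by
      rw [norm_mul, hn, Complex.norm_real, mul_one, one_mul]
      exact abs_le.mpr ⟨by nlinarith [sq_nonneg (x + 1)], by nlinarith [sq_nonneg (x - 1)]⟩)
  change ∫ x : ℝ, (x : ℂ) * e x ∂thermalMeasure q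
      = ((1 + q) / (1 - q) : ℝ) * (t * Complex.I) * ∫ x : ℝ, e x ∂thermalMeasure q
  set A := ∫ x : ℝ, e x ∂thermalMeasure q
  set D := ∫ x : ℝ, (x : ℂ) * e x ∂thermalMeasure q
  set J : ℕ → ℂ := fun n => √(n : ℝ) * ∫ x, (((hermiteNormed n).eval x *
    (hermiteNormed (n - 1)).eval x : ℝ) : ℂ) * e x ∂stdGaussianReal with hJ
  have hi : ∀ p q : Polynomial ℝ, Integrable
      (fun x => ((p.eval x * q.eval x : ℝ) : ℂ) * e x) stdGaussianReal := by
    intro p q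
    simpa using integrable_eval_mul_exp (p * q) t
  have h1 : ∀ n : ℕ, ∫ x, (hermiteNormed n).eval x ^ 2 • ((x : ℂ) * e x) ∂stdGaussianReal
      = J (n + 1) + J n := by
    intro n
    simp only [hJ]
    rw [← integral_const_mul, ← integral_const_mul, ← integral_add ((hi _ _).const_mul _)
      ((hi _ _).const_mul _)]
    refine integral_congr_ae (Eventually.of_forall fun x => ?_)
    have hx := congrArg (fun r : ℝ => (r : ℂ)) (mul_eval_hermiteNormed n x)
    simp only [Complex.ofReal_mul, Complex.ofReal_add] at hx
    simp only [Complex.real_smul, Nat.add_sub_cancel, Complex.ofReal_mul, Complex.ofReal_pow,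
      Nat.cast_add, Nat.cast_one]
    linear_combination (((hermiteNormed n).eval x : ℝ) : ℂ) * e x * hx
  have h2 : ∀ n : ℕ, ∫ x, (hermiteNormed n).eval x ^ 2 • ((x : ℂ) * e x) ∂stdGaussianReal
      = 2 * J n + t * Complex.I * ∫ x, (hermiteNormed n).eval x ^ 2 • e x ∂stdGaussianReal := by
    intro n
    have h := integral_mul_eval_mul_exp (hermiteNormed n ^ 2) t
    have e1 : ∀ x : ℝ, (((Polynomial.derivative (hermiteNormed n ^ 2)).eval x : ℝ) : ℂ) * e x
        = (2 * √(n : ℝ) : ℝ) * ((((hermiteNormed n).eval x *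
          (hermiteNormed (n - 1)).eval x : ℝ) : ℂ) * e x) := by
      intro x
      simp only [sq, Polynomial.derivative_mul, derivative_hermiteNormed, Polynomial.eval_mul,
        Polynomial.eval_add, Polynomial.eval_C]
      push_cast
      ring
    have e2 : ∀ x : ℝ, (((hermiteNormed n ^ 2).eval x : ℝ) : ℂ) * e x
        = (hermiteNormed n).eval x ^ 2 • e x := fun x => by
      rw [Polynomial.eval_pow, Complex.real_smul]
    have e3 : ∀ x : ℝ, (x : ℂ) * (((hermiteNormed n ^ 2).eval x : ℝ) : ℂ) * e x
        = (hermiteNormed n).eval x ^ 2 • ((x : ℂ) * e x) := fun x => by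
      rw [Polynomial.eval_pow, Complex.real_smul]; ring
    change ∫ x : ℝ, (x : ℂ) * (((hermiteNormed n ^ 2).eval x : ℝ) : ℂ) * e x ∂stdGaussianReal
      = (∫ x : ℝ, (((Polynomial.derivative (hermiteNormed n ^ 2)).eval x : ℝ) : ℂ) * e x
        ∂stdGaussianReal) + t * Complex.I *
        ∫ x : ℝ, (((hermiteNormed n ^ 2).eval x : ℝ) : ℂ) * e x ∂stdGaussianReal at h
    simp only [e1, e2, e3] at h
    rw [h, integral_const_mul]
    simp only [hJ]
    push_cast
    ring
  have h3 : HasSum (fun n : ℕ => ((1 - q) * q ^ n) • J n) ((D - t * Complex.I * A) / 2) := by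
    refine HasSum.congr_fun ((hD.sub (hA.mul_left (t * Complex.I))).div_const 2) fun n => Eq.symm ?_
    rw [h2]
    simp only [Complex.real_smul]
    push_cast
    ring
  have h4 : HasSum (fun n : ℕ => ((1 - q) * q ^ n) • J (n + 1))
      (D - (D - t * Complex.I * A) / 2) := by
    refine HasSum.congr_fun (hD.sub h3) fun n => Eq.symm ?_
    rw [h1]
    simp only [Complex.real_smul]
    push_cast
    ring
  have h5 := (hasSum_nat_add_iff' 1).mpr h3
  have h6 : HasSum (fun n : ℕ => ((1 - q) * q ^ (n + 1)) • J (n + 1))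
      ((q : ℂ) * (D - (D - t * Complex.I * A) / 2)) := by
    refine HasSum.congr_fun (h4.mul_left (q : ℂ)) fun n => Eq.symm ?_
    simp only [Complex.real_smul, pow_succ]
    push_cast
    ring
  have h7 := h5.unique h6
  have h8 : J 0 = 0 := by simp [hJ]
  simp only [Finset.range_one, Finset.sum_singleton, h8, smul_zero, sub_zero] at h7
  have h9 : (1 - q : ℂ) ≠ 0 := by
    rw [sub_ne_zero]
    exact_mod_cast hq1.ne'
  push_cast
  rw [div_mul_eq_mul_div, div_mul_eq_mul_div, eq_div_iff h9]
  linear_combination 2 * h7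

/-- The characteristic function solves `φ' = -v t φ` with `φ(0) = 1`, so `φ(t) e^{v t²/2}` is
constant. -/
lemma charFun_thermalMeasure {q : ℝ} (hq : 0 ≤ q) (hq1 : q < 1) (t : ℝ) :
    charFun (thermalMeasure q) t = Complex.exp (-((1 + q) / (1 - q) : ℝ) * t ^ 2 / 2) := by
  have := isProbabilityMeasure_thermalMeasure hq hq1
  set v : ℝ := (1 + q) / (1 - q)
  have hint : MemLp id (1 : ℕ) (thermalMeasure q) := by
    rw [Nat.cast_one, memLp_one_iff_integrable]
    refine integrable_sum_thermal hq hq1 continuous_id (C := 1) fun x => ?_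
    rw [id, Real.norm_eq_abs, one_mul]
    exact abs_le.mpr ⟨by nlinarith [sq_nonneg (x + 1)], by nlinarith [sq_nonneg (x - 1)]⟩
  have hd : ∀ t : ℝ, HasDerivAt (charFun (thermalMeasure q))
      (-(v * t) * charFun (thermalMeasure q) t) t := by
    intro t
    have h1 : DifferentiableAt ℝ (charFun (thermalMeasure q)) t :=
      (contDiff_charFun hint).differentiable (by simp) t
    have h2 := iteratedDeriv_charFun (t := t) hint
    rw [iteratedDeriv_one] at h2
    simp only [pow_one] at h2
    rw [integral_id_mul_exp_thermalMeasure hq hq1] at h2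
    refine h1.hasDerivAt.congr_deriv ?_
    rw [h2, charFun_apply_real]
    linear_combination (v * t * ∫ x : ℝ, Complex.exp (t * x * Complex.I) ∂thermalMeasure q)
      * Complex.I_mul_I
  have hg : ∀ t : ℝ, HasDerivAt (fun t : ℝ => charFun (thermalMeasure q) t *
      Complex.exp (v * t ^ 2 / 2)) 0 t := by
    intro t
    have h1 : HasDerivAt (fun t : ℝ => Complex.exp (v * t ^ 2 / 2))
        (Complex.exp (v * t ^ 2 / 2) * (v * t)) t := by
      have h0 : HasDerivAt (fun t : ℝ => (t : ℂ)) 1 t := (hasDerivAt_id t).ofReal_comp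
      refine (((h0.pow 2).const_mul (v : ℂ)).div_const 2).cexp.congr_deriv ?_
      simp
      ring
    refine ((hd t).mul h1).congr_deriv ?_
    ring
  have hc := is_const_of_deriv_eq_zero (fun t => (hg t).differentiableAt)
    (fun t => (hg t).deriv) t 0
  simp only [charFun_zero, probReal_univ] at hc
  rw [neg_mul, neg_div, Complex.exp_neg]
  refine eq_inv_of_mul_eq_one_left ?_
  simpa using hc

lemma thermalMeasure_eq_gaussianReal {q : ℝ} (hq : 0 ≤ q) (hq1 : q < 1) :
    thermalMeasure q = gaussianReal 0 ((1 + q) / (1 - q)).toNNReal := by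
  have := isProbabilityMeasure_thermalMeasure hq hq1
  have h0 : 0 ≤ (1 + q) / (1 - q) := div_nonneg (by linarith) (by linarith)
  refine Measure.ext_of_charFun (funext fun t => ?_)
  rw [charFun_thermalMeasure hq hq1, charFun_gaussianReal, Real.coe_toNNReal _ h0]
  congr 1
  push_cast
  ring

/-! ### The Jacobi recurrence of a field operator -/

/-- The Jacobi matrix with off-diagonal entries `a √(j + 1)` has no non-zero square-summable
generalized eigenvector for the eigenvalue `i`. -/
lemma eq_zero_of_jacobi_of_summable (a : ℝ) (w : ℕ → ℂ) (hw : Summable fun j => ‖w j‖ ^ 2)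
    (h : ∀ j, Complex.I * w j = a * (√(j + 1 : ℝ) * w (j + 1) + √(j : ℝ) * w (j - 1))) (m : ℕ) :
    w m = 0 := by
  -- Discrete Green identity: after multiplication of the recurrence by the conjugate of `w j`,
  -- imaginary parts telescope to a boundary current at `N`.
  have hsum : ∀ N : ℕ, ∑ j ∈ Finset.range (N + 1), ‖w j‖ ^ 2
      = a * √(N + 1 : ℝ) * (w (N + 1) * starRingEnd ℂ (w N)).im := by
    have step : ∀ j : ℕ, ‖w j‖ ^ 2 = a * √(j + 1 : ℝ) * (w (j + 1) * starRingEnd ℂ (w j)).im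
        + a * √(j : ℝ) * (w (j - 1) * starRingEnd ℂ (w j)).im := by
      intro j
      have e : Complex.I * ((‖w j‖ ^ 2 : ℝ) : ℂ)
          = ((a * √(j + 1 : ℝ) : ℝ) : ℂ) * (w (j + 1) * starRingEnd ℂ (w j))
          + ((a * √(j : ℝ) : ℝ) : ℂ) * (w (j - 1) * starRingEnd ℂ (w j)) := by
        have := h j
        push_cast
        rw [← Complex.mul_conj']
        linear_combination starRingEnd ℂ (w j) * this
      have e2 := congrArg Complex.im e
      rwa [Complex.add_im, Complex.im_ofReal_mul, Complex.im_ofReal_mul, Complex.I_mul_im,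
        Complex.ofReal_re] at e2
    intro N
    induction N with
    | zero => simpa using step 0
    | succ N ih =>
      rw [Finset.sum_range_succ, ih, step (N + 1)]
      have : (w N * starRingEnd ℂ (w (N + 1))).im = -(w (N + 1) * starRingEnd ℂ (w N)).im := by
        simp only [Complex.mul_im, Complex.conj_im, Complex.conj_re]
        ring
      simp only [Nat.add_sub_cancel, this, Nat.cast_add, Nat.cast_one]
      ring
  by_contra hm
  have hpos : 0 < ‖w m‖ ^ 2 := by positivity
  -- Carleman's argument: the current must dominate the fixed mass `‖w m‖²`, which forces a multiple
  -- of the harmonic series below a convergent one. The crude bound `√x ≤ x` for `x ≥ 1` suffices.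
  have hle : ∀ N : ℕ, ‖w m‖ ^ 2 * (1 / ((N + (m + 1) : ℕ) : ℝ))
      ≤ |a| * (‖w (N + m + 1)‖ ^ 2 + ‖w (N + m)‖ ^ 2) := by
    intro N
    have h1 : ‖w m‖ ^ 2 ≤ ∑ j ∈ Finset.range (N + m + 1), ‖w j‖ ^ 2 :=
      Finset.single_le_sum (f := fun j => ‖w j‖ ^ 2) (fun _ _ => by positivity)
        (Finset.mem_range.mpr (by omega))
    have hM : (1 : ℝ) ≤ ((N + m : ℕ) : ℝ) + 1 := by
      have : (0 : ℝ) ≤ ((N + m : ℕ) : ℝ) := Nat.cast_nonneg _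
      linarith
    have h2 : (w (N + m + 1) * starRingEnd ℂ (w (N + m))).im * a
        ≤ |a| * (‖w (N + m + 1)‖ ^ 2 + ‖w (N + m)‖ ^ 2) := by
      refine (le_abs_self _).trans ?_
      rw [abs_mul, mul_comm]
      refine mul_le_mul_of_nonneg_left ((Complex.abs_im_le_norm _).trans ?_) (abs_nonneg _)
      rw [norm_mul, RCLike.norm_conj]
      nlinarith [sq_nonneg (‖w (N + m + 1)‖ - ‖w (N + m)‖), sq_nonneg ‖w (N + m + 1)‖,
        sq_nonneg ‖w (N + m)‖]
    have h3 : √(((N + m : ℕ) : ℝ) + 1) ≤ ((N + m : ℕ) : ℝ) + 1 := by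
      rw [Real.sqrt_le_left (by linarith)]
      nlinarith
    rw [hsum] at h1
    have hc : ((N + (m + 1) : ℕ) : ℝ) = ((N + m : ℕ) : ℝ) + 1 := by push_cast; ring
    rw [hc, mul_one_div, div_le_iff₀ (by linarith)]
    refine h1.trans ?_
    have hr : 0 ≤ |a| * (‖w (N + m + 1)‖ ^ 2 + ‖w (N + m)‖ ^ 2) := by positivity
    calc _ = √(((N + m : ℕ) : ℝ) + 1) * ((w (N + m + 1) * starRingEnd ℂ (w (N + m))).im * a) := by
          ring
      _ ≤ √(((N + m : ℕ) : ℝ) + 1) * (|a| * (‖w (N + m + 1)‖ ^ 2 + ‖w (N + m)‖ ^ 2)) :=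
          mul_le_mul_of_nonneg_left h2 (Real.sqrt_nonneg _)
      _ ≤ _ := by
          rw [mul_comm]
          exact mul_le_mul_of_nonneg_left h3 hr
  have hs : Summable fun N : ℕ => |a| * (‖w (N + m + 1)‖ ^ 2 + ‖w (N + m)‖ ^ 2) :=
    (((summable_nat_add_iff (m + 1)).mpr hw).add ((summable_nat_add_iff m).mpr hw)).mul_left _
  have h4 := Summable.of_nonneg_of_le (fun N => by positivity) hle hs
  rw [summable_mul_left_iff hpos.ne'] at h4
  exact Real.not_summable_one_div_natCast ((summable_nat_add_iff (m + 1)).mp h4)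

lemma I_sub_ofReal_ne_zero (r : ℝ) : Complex.I - (r : ℂ) ≠ 0 := by
  intro h
  simpa using congrArg Complex.im h

lemma norm_inv_I_sub_ofReal_le (r : ℝ) : ‖(Complex.I - (r : ℂ))⁻¹‖ ≤ 1 := by
  rw [norm_inv]
  refine inv_le_one_of_one_le₀ ?_
  simpa using Complex.abs_im_le_norm (Complex.I - (r : ℂ))

lemma continuous_inv_I_sub (a : ℝ) : Continuous fun x : ℝ => (Complex.I - ((a * x : ℝ) : ℂ))⁻¹ :=
  Continuous.inv₀ (by fun_prop) fun x => I_sub_ofReal_ne_zero _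

/-- Matrix elements of `(i - a x)⁻¹` between normalized Hermite polynomials. -/
noncomputable def hermiteResolvent (a : ℝ) (j k : ℕ) : ℂ :=
  ∫ x : ℝ, (((hermiteNormed j).eval x * (hermiteNormed k).eval x : ℝ) : ℂ) *
    (Complex.I - ((a * x : ℝ) : ℂ))⁻¹ ∂stdGaussianReal

/-- Integrate `h_j h_k` against `(i - a x)(i - a x)⁻¹ = 1` and expand `x h_j`. -/
lemma hermiteResolvent_recurrence (a : ℝ) (j k : ℕ) :
    Complex.I * hermiteResolvent a j k = (if j = k then 1 else 0)
      + a * (√(j + 1 : ℝ) * hermiteResolvent a (j + 1) k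
        + √(j : ℝ) * hermiteResolvent a (j - 1) k) := by
  have hi : ∀ p : Polynomial ℝ, Integrable (fun x : ℝ => ((p.eval x : ℝ) : ℂ) *
      (Complex.I - ((a * x : ℝ) : ℂ))⁻¹) stdGaussianReal := fun p =>
    integrable_eval_mul_stdGaussianReal p (continuous_inv_I_sub a)
      fun x => norm_inv_I_sub_ofReal_le _
  have hi2 : ∀ p q : Polynomial ℝ, Integrable (fun x : ℝ => ((p.eval x * q.eval x : ℝ) : ℂ) *
      (Complex.I - ((a * x : ℝ) : ℂ))⁻¹) stdGaussianReal := fun p q => by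
    simpa only [Polynomial.eval_mul] using hi (p * q)
  have hh : ∫ x, (((hermiteNormed j).eval x * (hermiteNormed k).eval x : ℝ) : ℂ)
      ∂stdGaussianReal = if j = k then 1 else 0 := by
    rw [integral_complex_ofReal, integral_hermiteNormed_mul]
    split_ifs <;> simp
  have hh2 : Integrable (fun x => (((hermiteNormed j).eval x * (hermiteNormed k).eval x : ℝ) : ℂ))
      stdGaussianReal := by
    have := integrable_eval_mul_stdGaussianReal (hermiteNormed j * hermiteNormed k)
      (continuous_const (y := (1 : ℂ))) (C := 1) (by simp)
    simpa only [Polynomial.eval_mul, mul_one] using this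
  unfold hermiteResolvent
  rw [← hh, ← integral_const_mul, ← integral_const_mul, ← integral_const_mul,
    ← integral_add ((hi2 _ _).const_mul _) ((hi2 _ _).const_mul _), ← integral_const_mul,
    ← integral_add hh2
      (by exact (((hi2 _ _).const_mul _).add ((hi2 _ _).const_mul _)).const_mul _)]
  refine integral_congr_ae (Eventually.of_forall fun x => ?_)
  have hx := congrArg (fun r : ℝ => (r : ℂ)) (mul_eval_hermiteNormed j x)
  have h0 := mul_inv_cancel₀ (I_sub_ofReal_ne_zero (a * x))
  simp only [Complex.ofReal_mul, Complex.ofReal_add] at hx h0 ⊢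
  set r := (Complex.I - (a : ℂ) * x)⁻¹
  linear_combination (((hermiteNormed j).eval x : ℝ) : ℂ) * (((hermiteNormed k).eval x : ℝ) : ℂ)
    * h0 + a * (((hermiteNormed k).eval x : ℝ) : ℂ) * r * hx

lemma memLp_two_hermiteNormed_mul (k : ℕ) {f : ℝ → ℂ} (hf : Continuous f)
    (hf1 : ∀ x, ‖f x‖ ≤ 1) :
    MemLp (fun x : ℝ => (((hermiteNormed k).eval x : ℝ) : ℂ) * f x) 2 stdGaussianReal := by
  have hm : Continuous fun x : ℝ => (((hermiteNormed k).eval x : ℝ) : ℂ) * f x := by fun_prop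
  rw [memLp_two_iff_integrable_sq_norm hm.aestronglyMeasurable]
  have := integrable_eval_stdGaussianReal (hermiteNormed k ^ 2)
  refine this.mono' (Continuous.aestronglyMeasurable (by fun_prop))
    (Eventually.of_forall fun x => ?_)
  rw [norm_pow, norm_norm, norm_mul, mul_pow, Complex.norm_real, Real.norm_eq_abs, sq_abs,
    Polynomial.eval_pow]
  exact mul_le_of_le_one_right (sq_nonneg _) (pow_le_one₀ (norm_nonneg _) (hf1 x))

/-- Bessel's inequality for the `L²(γ)` function `h_k (i - a x)⁻¹` and the orthonormal system `h_j`.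
-/
lemma summable_norm_sq_hermiteResolvent (a : ℝ) (k : ℕ) :
    Summable fun j => ‖hermiteResolvent a j k‖ ^ 2 := by
  have hH : ∀ j : ℕ, MemLp (fun x : ℝ => (((hermiteNormed j).eval x : ℝ) : ℂ)) 2
      stdGaussianReal := fun j => by
    simpa using memLp_two_hermiteNormed_mul j (continuous_const (y := (1 : ℂ))) (by simp)
  have hF := memLp_two_hermiteNormed_mul k (continuous_inv_I_sub a)
    fun x => norm_inv_I_sub_ofReal_le _
  have ho : Orthonormal ℂ fun j : ℕ => (hH j).toLp _ := by
    classical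
    rw [orthonormal_iff_ite]
    intro i j
    rw [L2.inner_def]
    have : ∫ x, inner ℂ ((hH i).toLp _ x) ((hH j).toLp _ x) ∂stdGaussianReal
        = ∫ x, (((hermiteNormed i).eval x * (hermiteNormed j).eval x : ℝ) : ℂ)
          ∂stdGaussianReal := by
      refine integral_congr_ae ?_
      filter_upwards [(hH i).coeFn_toLp, (hH j).coeFn_toLp] with x h1 h2
      rw [h1, h2]
      simp [mul_comm]
    rw [this, integral_complex_ofReal, integral_hermiteNormed_mul]
    split_ifs <;> simp
  have h := ho.inner_products_summable (x := hF.toLp _)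
  refine h.congr fun j => ?_
  congr 2
  rw [L2.inner_def]
  refine integral_congr_ae ?_
  filter_upwards [(hH j).coeFn_toLp, hF.coeFn_toLp] with x h1 h2
  rw [h1, h2]
  simp
  ring

/-- A square-summable solution of the inhomogeneous Jacobi recurrence is given by the matrix
elements of the resolvent in the Hermite basis. -/
lemma eq_hermiteResolvent_of_jacobi (a : ℝ) (k : ℕ) (u : ℕ → ℂ)
    (hu : Summable fun j => ‖u j‖ ^ 2)
    (h : ∀ j, Complex.I * u j = (if j = k then 1 else 0)
      + a * (√(j + 1 : ℝ) * u (j + 1) + √(j : ℝ) * u (j - 1))) (j : ℕ) :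
    u j = hermiteResolvent a j k := by
  have hs := summable_norm_sq_hermiteResolvent a k
  rw [← sub_eq_zero]
  refine eq_zero_of_jacobi_of_summable a (fun j => u j - hermiteResolvent a j k) ?_ (fun j => ?_) j
  · refine Summable.of_nonneg_of_le (fun j => by positivity) (fun j => ?_)
      ((hu.add hs).mul_left 2)
    have h1 := norm_sub_le (u j) (hermiteResolvent a j k)
    have h2 := pow_le_pow_left₀ (norm_nonneg _) h1 2
    nlinarith [sq_nonneg (‖u j‖ - ‖hermiteResolvent a j k‖)]
  · have h1 := h j
    have h2 := hermiteResolvent_recurrence a j k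
    linear_combination h1 - h2

/-! ### The field operator of a single mode and its resolvent -/

section Operator

variable {ι : Type}

lemma occ_apply [DecidableEq (ι →₀ ℕ)] (n m : ι →₀ ℕ) :
    (occ n : Fock ι) m = if m = n then 1 else 0 := by
  have h : (occ n : Fock ι) = lp.single 2 n 1 := by
    unfold occ
    convert rfl
  rw [h, lp.single_apply]
  split_ifs with h1
  · subst h1; simp
  · simp [h1]

lemma inner_occ_left (n : ι →₀ ℕ) (x : Fock ι) : inner ℂ (occ n) x = x n := by
  let := Classical.decEq (ι →₀ ℕ)
  change inner ℂ (lp.single 2 n (1 : ℂ)) x = x n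
  rw [lp.inner_single_left]
  simp

lemma inner_occ_right (n : ι →₀ ℕ) (x : Fock ι) :
    inner ℂ x (occ n) = starRingEnd ℂ (x n) := by
  rw [← inner_conj_symm, inner_occ_left]

lemma summable_norm_sq (x : Fock ι) : Summable fun n => ‖x n‖ ^ 2 := by
  have := (lp.memℓp x).summable (by simp)
  simpa using this

lemma finVec_single (n : ι →₀ ℕ) : finVec (Finsupp.single n (1 : ℂ)) = occ n := by
  simp [finVec]

lemma mem_segalGraph (f : ι → ℂ) (v : (ι →₀ ℕ) →₀ ℂ) :
    (finVec v, segalFin f v) ∈ segalGraph f :=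
  Submodule.le_topologicalClosure _ ⟨v, rfl⟩

lemma segalGraph_induction (f : ι → ℂ) {P : Fock ι × Fock ι → Prop}
    (hP : IsClosed {p | P p}) (h : ∀ v, P (finVec v, segalFin f v)) {p : Fock ι × Fock ι}
    (hp : p ∈ segalGraph f) : P p := by
  have hp' : p ∈ closure (LinearMap.range ((finVec (ι := ι)).prod (segalFin f)) :
      Set (Fock ι × Fock ι)) := by
    rw [← Submodule.topologicalClosure_coe]
    exact hp
  refine closure_minimal ?_ hP hp'
  rintro _ ⟨v, rfl⟩
  exact h v

/-- The map `(ψ, Φ ψ) ↦ i ψ - Φ ψ` on the graph of the field operator. -/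
noncomputable def graphShift (f : ι → ℂ) : segalGraph f →L[ℂ] Fock ι :=
  (Complex.I • ContinuousLinearMap.fst ℂ (Fock ι) (Fock ι)
    - ContinuousLinearMap.snd ℂ (Fock ι) (Fock ι)).comp (segalGraph f).subtypeL

lemma graphShift_apply (f : ι → ℂ) (p : segalGraph f) :
    graphShift f p = Complex.I • p.1.1 - p.1.2 := rfl

/-- The occupation numbers `n` with the occupation of the mode `i` replaced by `j`. -/
noncomputable def fibre (i : ι) (n : ι →₀ ℕ) (j : ℕ) : ι →₀ ℕ := n.erase i + Finsupp.single i j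

lemma fibre_apply_self (i : ι) (n : ι →₀ ℕ) (j : ℕ) : fibre i n j i = j := by
  simp [fibre]

lemma fibre_self (i : ι) (n : ι →₀ ℕ) : fibre i n (n i) = n := by
  rw [fibre, add_comm, Finsupp.single_add_erase]

lemma fibre_add (i : ι) (n : ι →₀ ℕ) (j : ℕ) :
    fibre i n j + Finsupp.single i 1 = fibre i n (j + 1) := by
  rw [fibre, fibre, add_assoc, Finsupp.single_add]

lemma fibre_injective (i : ι) (n : ι →₀ ℕ) : Function.Injective (fibre i n) := fun j k h => by
  rw [← fibre_apply_self i n j, h, fibre_apply_self]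

lemma summable_fibre (x : Fock ι) (i : ι) (n : ι →₀ ℕ) :
    Summable fun j => ‖x (fibre i n j)‖ ^ 2 :=
  (summable_norm_sq x).comp_injective (fibre_injective i n)

variable [DecidableEq ι]

/-- `Φ(c δᵢ)|n⟩ = a (√(nᵢ + 1) |n + δᵢ⟩ + √nᵢ |n - δᵢ⟩)` with `a = c / √2`. -/
noncomputable def modeField (a : ℝ) (i : ι) (n : ι →₀ ℕ) : Fock ι :=
  ((a * √(n i + 1 : ℝ) : ℝ) : ℂ) • occ (n + Finsupp.single i 1)
    + ((a * √(n i : ℝ) : ℝ) : ℂ) • occ (n - Finsupp.single i 1)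

lemma creationOcc_single (c : ℝ) (i : ι) (n : ι →₀ ℕ) :
    creationOcc (Pi.single i (c : ℂ)) n
      = ((c : ℂ) * (√(n i + 1 : ℝ) : ℂ)) • occ (n + Finsupp.single i 1) := by
  unfold creationOcc
  rw [tsum_eq_single i]
  · simp
  · intro k hk
    simp [Pi.single_eq_of_ne hk]

lemma annihilationOcc_single (c : ℝ) (i : ι) (n : ι →₀ ℕ) :
    annihilationOcc (Pi.single i (c : ℂ)) n
      = ((c : ℂ) * (√(n i : ℝ) : ℂ)) • occ (n - Finsupp.single i 1) := by
  unfold annihilationOcc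
  rw [Finset.sum_eq_single i]
  · simp
  · intro k _ hk
    simp [Pi.single_eq_of_ne hk]
  · intro hi
    rw [Finsupp.notMem_support_iff] at hi
    simp [hi]

lemma segalFin_single (c : ℝ) (i : ι) (n : ι →₀ ℕ) :
    segalFin (Pi.single i (c : ℂ)) (Finsupp.single n 1) = modeField (c / √2) i n := by
  unfold segalFin modeField
  rw [Finsupp.linearCombination_single, one_smul, creationOcc_single, annihilationOcc_single,
    smul_add, smul_smul, smul_smul]
  congr 2 <;> push_cast <;> ring

lemma sub_single_add_single {i : ι} {n : ι →₀ ℕ} (h : n i ≠ 0) :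
    n - Finsupp.single i 1 + Finsupp.single i 1 = n := by
  ext k
  by_cases hk : k = i
  · subst hk; simp; omega
  · simp [Finsupp.single_eq_of_ne hk]

lemma inner_occ_modeField (a : ℝ) (i : ι) (m n : ι →₀ ℕ) :
    inner ℂ (occ m) (modeField a i n) = inner ℂ (modeField a i m) (occ n) := by
  classical
  -- Raising and lowering are adjoint. When `m i = 0` truncated subtraction may satisfy the
  -- condition on the right, but the coefficient `√(m i)` is then zero.
  have key : ∀ m n : ι →₀ ℕ, (if m = n + Finsupp.single i 1 then √(n i + 1 : ℝ) else 0)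
      = if n = m - Finsupp.single i 1 then √(m i : ℝ) else 0 := by
    intro m n
    by_cases hm : m i = 0
    · rw [if_neg, hm]
      · simp
      · rintro rfl
        simp at hm
    · by_cases h : m = n + Finsupp.single i 1
      · have h2 : n = m - Finsupp.single i 1 := by rw [h, add_tsub_cancel_right]
        rw [if_pos h, if_pos h2, h]
        simp
      · rw [if_neg h, if_neg]
        rintro rfl
        exact h (sub_single_add_single hm).symm
  rw [inner_occ_left, inner_occ_right]
  have hl : (modeField a i n : Fock ι) m
      = ((a * (if m = n + Finsupp.single i 1 then √(n i + 1 : ℝ) else 0)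
        + a * (if m = n - Finsupp.single i 1 then √(n i : ℝ) else 0) : ℝ) : ℂ) := by
    unfold modeField
    rw [lp.coeFn_add, Pi.add_apply, lp.coeFn_smul, lp.coeFn_smul, Pi.smul_apply, Pi.smul_apply,
      occ_apply, occ_apply]
    push_cast
    split_ifs <;> simp
  have hr : (modeField a i m : Fock ι) n
      = ((a * (if n = m + Finsupp.single i 1 then √(m i + 1 : ℝ) else 0)
        + a * (if n = m - Finsupp.single i 1 then √(m i : ℝ) else 0) : ℝ) : ℂ) := by
    unfold modeField
    rw [lp.coeFn_add, Pi.add_apply, lp.coeFn_smul, lp.coeFn_smul, Pi.smul_apply, Pi.smul_apply,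
      occ_apply, occ_apply]
    push_cast
    split_ifs <;> simp
  rw [hl, hr, Complex.conj_ofReal, key m n, ← key n m]
  ring_nf

lemma inner_finVec_segalFin (c : ℝ) (i : ι) (v w : (ι →₀ ℕ) →₀ ℂ) :
    inner ℂ (finVec v) (segalFin (Pi.single i (c : ℂ)) w)
      = inner ℂ (segalFin (Pi.single i (c : ℂ)) v) (finVec w) := by
  induction v using Finsupp.induction_linear with
  | zero => simp
  | add f g hf hg => simp only [map_add, inner_add_left, hf, hg]
  | single m b =>
    induction w using Finsupp.induction_linear with
    | zero => simp
    | add f g hf hg => simp only [map_add, inner_add_right, hf, hg]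
    | single n b' =>
      have e : ∀ (n : ι →₀ ℕ) (b : ℂ), Finsupp.single n b = b • Finsupp.single n 1 := by simp
      rw [e m, e n, map_smul, map_smul, map_smul, map_smul, inner_smul_left, inner_smul_right,
        inner_smul_left, inner_smul_right, segalFin_single, segalFin_single, finVec_single,
        finVec_single, inner_occ_modeField]

lemma inner_finVec_of_mem_segalGraph (c : ℝ) (i : ι) {p : Fock ι × Fock ι}
    (hp : p ∈ segalGraph (Pi.single i (c : ℂ))) (v : (ι →₀ ℕ) →₀ ℂ) :
    inner ℂ (finVec v) p.2 = inner ℂ (segalFin (Pi.single i (c : ℂ)) v) p.1 := by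
  refine segalGraph_induction (Pi.single i (c : ℂ)) (P := fun p => inner ℂ (finVec v) p.2
    = inner ℂ (segalFin (Pi.single i (c : ℂ)) v) p.1) ?_ (fun w => ?_) hp
  · exact isClosed_eq (by fun_prop) (by fun_prop)
  · exact inner_finVec_segalFin c i v w

lemma im_inner_of_mem_segalGraph (c : ℝ) (i : ι) {p : Fock ι × Fock ι}
    (hp : p ∈ segalGraph (Pi.single i (c : ℂ))) : (inner ℂ p.1 p.2).im = 0 := by
  refine segalGraph_induction (Pi.single i (c : ℂ)) (P := fun p => (inner ℂ p.1 p.2).im = 0)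
    ?_ (fun v => ?_) hp
  · exact isClosed_eq (by fun_prop) continuous_const
  · have h := inner_finVec_segalFin c i v v
    rw [← inner_conj_symm (segalFin _ v)] at h
    have := congrArg Complex.im h
    rw [Complex.conj_im] at this
    simp only
    linarith

/-- The coordinate formula survives the closure of the graph because the field is symmetric and
pairing with a fixed vector is continuous. -/
lemma modeField_coordinates (c : ℝ) (i : ι) {p : Fock ι × Fock ι}
    (hp : p ∈ segalGraph (Pi.single i (c : ℂ))) (m : ι →₀ ℕ) :
    p.2 m = ((c / √2 : ℝ) : ℂ) * (√(m i + 1 : ℝ) * p.1 (m + Finsupp.single i 1)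
      + √(m i : ℝ) * p.1 (m - Finsupp.single i 1)) := by
  have h := inner_finVec_of_mem_segalGraph c i hp (Finsupp.single m 1)
  rw [finVec_single, inner_occ_left, segalFin_single] at h
  rw [h]
  unfold modeField
  rw [inner_add_left, inner_smul_left, inner_smul_left, inner_occ_left, inner_occ_left,
    Complex.conj_ofReal, Complex.conj_ofReal]
  push_cast
  ring

/-- Symmetry kills the cross term: `‖iψ - Φψ‖² = ‖ψ‖² + ‖Φψ‖²`, which dominates the square of the
sup norm on the graph. -/
lemma norm_le_norm_graphShift (c : ℝ) (i : ι) (p : segalGraph (Pi.single i (c : ℂ))) :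
    ‖p‖ ≤ ‖graphShift _ p‖ := by
  have h := im_inner_of_mem_segalGraph c i p.2
  have h2 : ‖graphShift _ p‖ ^ 2 = ‖p.1.1‖ ^ 2 + ‖p.1.2‖ ^ 2 := by
    rw [graphShift_apply, @norm_sub_sq ℂ, inner_smul_left, norm_smul]
    simp [h]
  rw [Submodule.coe_norm, Prod.norm_def]
  refine max_le ?_ ?_
  · exact abs_le_of_sq_le_sq' (by nlinarith [sq_nonneg ‖p.1.2‖]) (norm_nonneg _) |>.2
  · exact abs_le_of_sq_le_sq' (by nlinarith [sq_nonneg ‖p.1.1‖]) (norm_nonneg _) |>.2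

lemma fibre_sub (i : ι) (n : ι →₀ ℕ) (j : ℕ) :
    fibre i n j - Finsupp.single i 1 = fibre i n (j - 1) := by
  ext k
  by_cases hk : k = i
  · subst hk; simp [fibre]
  · simp [fibre, Finsupp.single_eq_of_ne hk]

/-- The conjugated coordinates of a vector orthogonal to the range solve the homogeneous Jacobi
recurrence at `i` along each fibre, so they vanish. This is the deficiency-index half of
self-adjointness. -/
lemma range_graphShift_orthogonal (c : ℝ) (i : ι) :
    (LinearMap.range (graphShift (Pi.single i (c : ℂ))).toLinearMap)ᗮ = ⊥ := by
  rw [eq_bot_iff]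
  intro x hx
  rw [Submodule.mem_orthogonal] at hx
  have h : ∀ m : ι →₀ ℕ, Complex.I * starRingEnd ℂ (x m) = ((c / √2 : ℝ) : ℂ) *
      (√(m i + 1 : ℝ) * starRingEnd ℂ (x (m + Finsupp.single i 1))
      + √(m i : ℝ) * starRingEnd ℂ (x (m - Finsupp.single i 1))) := by
    intro m
    have h1 := hx (graphShift _ ⟨_, mem_segalGraph (Pi.single i (c : ℂ)) (Finsupp.single m 1)⟩)
      ⟨_, rfl⟩
    rw [graphShift_apply] at h1
    simp only [finVec_single, segalFin_single, modeField] at h1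
    rw [inner_sub_left, inner_add_left, inner_smul_left, inner_smul_left, inner_smul_left,
      inner_occ_left, inner_occ_left, inner_occ_left] at h1
    have h2 := congrArg (starRingEnd ℂ) h1
    simp only [map_sub, map_add, map_mul, Complex.conj_ofReal, Complex.conj_I, map_neg,
      map_zero] at h2
    push_cast at h2 ⊢
    linear_combination h2
  rw [Submodule.mem_bot]
  ext n
  have h0 := eq_zero_of_jacobi_of_summable (c / √2) (fun j => starRingEnd ℂ (x (fibre i n j)))
    (by simpa using summable_fibre x i n) (fun j => by
      have := h (fibre i n j)
      rwa [fibre_apply_self, fibre_add, fibre_sub] at this) (n i)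
  simpa [fibre_self] using h0

/-- Bounded below on a complete graph, the map is injective with closed range; the range is
everything since its orthogonal complement is trivial. -/
lemma bijective_graphShift (c : ℝ) (i : ι) :
    Function.Bijective (graphShift (Pi.single i (c : ℂ))) := by
  have hc : CompleteSpace (segalGraph (Pi.single i (c : ℂ))) :=
    (Submodule.isClosed_topologicalClosure _).completeSpace_coe
  have ha : AntilipschitzWith 1 (graphShift (Pi.single i (c : ℂ))) :=
    AddMonoidHomClass.antilipschitz_of_bound _ fun p => by
      simpa using norm_le_norm_graphShift c i p
  refine ⟨ha.injective, ?_⟩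
  have hcl := ha.isClosed_range (graphShift (Pi.single i (c : ℂ))).uniformContinuous
  have : CompleteSpace (LinearMap.range (graphShift (Pi.single i (c : ℂ))).toLinearMap) :=
    IsClosed.completeSpace_coe (hs := hcl)
  have ht := Submodule.orthogonal_eq_bot_iff.mp (range_graphShift_orthogonal c i)
  exact LinearMap.range_eq_top.mp ht

lemma exists_isResolvent (c : ℝ) (i : ι) :
    ∃ R : Fock ι →L[ℂ] Fock ι, IsResolvent 1 (Pi.single i (c : ℂ)) R := by
  have hc : CompleteSpace (segalGraph (Pi.single i (c : ℂ))) :=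
    (Submodule.isClosed_topologicalClosure _).completeSpace_coe
  obtain ⟨h1, h2⟩ := bijective_graphShift c i
  let e := ContinuousLinearEquiv.ofBijective (graphShift (Pi.single i (c : ℂ)))
    (LinearMap.ker_eq_bot.mpr h1) (LinearMap.range_eq_top.mpr h2)
  have he : ∀ p, e p = Complex.I • p.1.1 - p.1.2 := fun p => rfl
  refine ⟨((ContinuousLinearMap.fst ℂ (Fock ι) (Fock ι)).comp
    (segalGraph (Pi.single i (c : ℂ))).subtypeL).comp e.symm.toContinuousLinearMap,
    fun φ ψ => ⟨fun h => ?_, fun h => ?_⟩⟩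
  · have h3 := e.apply_symm_apply φ
    rw [he] at h3
    have h4 : (e.symm φ).1.1 = ψ := h
    have h5 : (e.symm φ).1 = (ψ, (Complex.I * ((1 : ℝ) : ℂ)) • ψ - φ) := by
      refine Prod.ext h4 ?_
      have h6 := sub_eq_iff_eq_add.mp h3
      rw [h4] at h6
      simp [h6]
    rw [← h5]
    exact (e.symm φ).2
  · have h3 : e ⟨_, h⟩ = φ := by rw [he]; simp
    have h4 : e.symm φ = ⟨_, h⟩ := e.symm_apply_eq.mpr h3.symm
    change (e.symm φ).1.1 = ψ
    rw [h4]

/-- `resolvent` is a choice by `epsilon`, meaningful only once existence is known. -/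
lemma isResolvent_resolvent (c : ℝ) (i : ι) :
    IsResolvent 1 (Pi.single i (c : ℂ)) (resolvent 1 (Pi.single i (c : ℂ))) :=
  Classical.epsilon_spec (exists_isResolvent c i)

/-- Diagonal matrix elements of the resolvent of the field operator of one mode. -/
lemma inner_occ_resolvent (c : ℝ) (i : ι) (n : ι →₀ ℕ) :
    inner ℂ (occ n) (resolvent 1 (Pi.single i (c : ℂ)) (occ n))
      = hermiteResolvent (c / √2) (n i) (n i) := by
  classical
  rw [inner_occ_left]
  set ψ := resolvent 1 (Pi.single i (c : ℂ)) (occ n) with hψ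
  have hg := (isResolvent_resolvent c i (occ n) ψ).mp hψ.symm
  -- Along the fibre through `n`, the coordinates of `R|n⟩` solve the Jacobi recurrence with a unit
  -- source at `j = n i`.
  have h := eq_hermiteResolvent_of_jacobi (c / √2) (n i) (fun j => ψ (fibre i n j))
    (summable_fibre ψ i n) (fun j => ?_) (n i)
  · simpa only [fibre_self] using h
  · have hj := modeField_coordinates c i hg (fibre i n j)
    rw [fibre_apply_self, fibre_add, fibre_sub, lp.coeFn_sub, Pi.sub_apply, lp.coeFn_smul,
      Pi.smul_apply, occ_apply] at hj
    have e : (fibre i n j = n) ↔ j = n i := by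
      refine ⟨fun h => by rw [← h, fibre_apply_self], fun h => by rw [h, fibre_self]⟩
    simp only [e, Complex.ofReal_one, mul_one, smul_eq_mul] at hj
    rw [← hj]
    ring

end Operator

/-! ### The grand canonical state of a function of one occupation number -/

section Gibbs

variable {ι : Type}

/-- The weight `∏ₖ qₖ^(nₖ)` of an occupation number configuration. -/
noncomputable def occWeight (q : ι → ℝ) (n : ι →₀ ℕ) : ℝ := n.prod fun k m => q k ^ m

lemma gibbsWeight_eq_occWeight (h : ι → ℝ) (β μ : ℝ) :
    gibbsWeight h β μ = occWeight fun k => Real.exp (-β * (h k - μ)) := by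
  funext n
  unfold gibbsWeight occWeight Finsupp.sum Finsupp.prod
  rw [Finset.mul_sum, Real.exp_sum]
  refine Finset.prod_congr rfl fun k _ => ?_
  change Real.exp (-β * ((n k : ℝ) * (h k - μ))) = Real.exp (-β * (h k - μ)) ^ n k
  rw [← Real.exp_nat_mul]
  congr 1
  ring

lemma occWeight_nonneg {q : ι → ℝ} (h0 : ∀ k, 0 ≤ q k) (n : ι →₀ ℕ) : 0 ≤ occWeight q n :=
  Finset.prod_nonneg fun k _ => pow_nonneg (h0 k) _

lemma occWeight_add_single (q : ι → ℝ) (n : ι →₀ ℕ) (i : ι) (j : ℕ) :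
    occWeight q (n + Finsupp.single i j) = q i ^ j * occWeight q n := by
  have h : (Finsupp.single i j).prod (fun k m => q k ^ m) = q i ^ j :=
    Finsupp.prod_single_index (pow_zero _)
  unfold occWeight
  rw [Finsupp.prod_add_index' (fun _ => pow_zero _) (fun k a b => pow_add _ _ _), h, mul_comm]

lemma sum_finsupp_occWeight (q : ι → ℝ) (S : Finset ι) (M : ℕ) :
    ∑ n ∈ S.finsupp (fun _ => Finset.range M), occWeight q n
      = ∏ k ∈ S, ∑ m ∈ Finset.range M, q k ^ m := by
  classical
  rw [Finset.prod_sum]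
  unfold Finset.finsupp
  rw [Finset.sum_map]
  refine Finset.sum_congr rfl fun p _ => ?_
  unfold occWeight
  rw [Finsupp.prod_of_support_subset (s := S) _ (by exact Finsupp.support_indicator_subset S p) _
    (fun _ _ => pow_zero _), ← Finset.prod_attach]
  refine Finset.prod_congr rfl fun k _ => ?_
  simp [Finsupp.indicator_of_mem k.2]

/-- Finitely many configurations involve finitely many modes and bounded occupations, where the sum
factors into truncated geometric sums. Each factor is at most `1/(1-q) = 1 + q/(1-q) ≤
exp(q/(1-q))`. -/
lemma summable_occWeight {q : ι → ℝ} (h0 : ∀ k, 0 ≤ q k) (h1 : ∀ k, q k < 1)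
    (hs : Summable fun k => q k / (1 - q k)) : Summable (occWeight q) := by
  classical
  refine summable_of_sum_le (c := Real.exp (∑' k, q k / (1 - q k))) (occWeight_nonneg h0)
    fun T => ?_
  let S := T.biUnion Finsupp.support
  let M := (T.sup fun n => n.support.sup n) + 1
  have hT : T ⊆ S.finsupp fun _ => Finset.range M := by
    intro n hn
    rw [Finset.mem_finsupp_iff]
    refine ⟨Finset.subset_biUnion_of_mem Finsupp.support hn, fun k _ => ?_⟩
    rw [Finset.mem_range, Nat.lt_succ_iff]
    by_cases hk : n k = 0
    · rw [hk]; exact Nat.zero_le _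
    · exact (Finset.le_sup (f := n) (Finsupp.mem_support_iff.mpr hk)).trans
        (Finset.le_sup (f := fun n : ι →₀ ℕ => n.support.sup n) hn)
  have hpos : ∀ k, 0 ≤ q k / (1 - q k) := fun k => div_nonneg (h0 k) (by linarith [h1 k])
  calc ∑ n ∈ T, occWeight q n ≤ ∑ n ∈ S.finsupp (fun _ => Finset.range M), occWeight q n :=
        Finset.sum_le_sum_of_subset_of_nonneg hT fun n _ _ => occWeight_nonneg h0 n
    _ = ∏ k ∈ S, ∑ m ∈ Finset.range M, q k ^ m := sum_finsupp_occWeight q S M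
    _ ≤ ∏ k ∈ S, Real.exp (q k / (1 - q k)) := by
        refine Finset.prod_le_prod (fun k _ => Finset.sum_nonneg fun m _ => pow_nonneg (h0 k) m)
          fun k _ => ?_
        have hg := (summable_geometric_of_lt_one (h0 k) (h1 k)).sum_le_tsum (Finset.range M)
          fun m _ => pow_nonneg (h0 k) m
        rw [tsum_geometric_of_lt_one (h0 k) (h1 k)] at hg
        refine hg.trans (le_trans (le_of_eq ?_) (Real.add_one_le_exp _))
        have : 1 - q k ≠ 0 := by linarith [h1 k]
        field_simp
        ring
    _ = Real.exp (∑ k ∈ S, q k / (1 - q k)) := (Real.exp_sum _ _).symm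
    _ ≤ _ := Real.exp_le_exp.mpr (hs.sum_le_tsum S fun k _ => hpos k)

/-- Splitting off the occupation number of one mode. -/
noncomputable def splitMode (i : ι) : (ι →₀ ℕ) ≃ ℕ × {m : ι →₀ ℕ // m i = 0} where
  toFun n := (n i, ⟨n.erase i, by simp⟩)
  invFun p := p.2.1 + Finsupp.single i p.1
  left_inv n := by
    change n.erase i + Finsupp.single i (n i) = n
    rw [add_comm, Finsupp.single_add_erase]
  right_inv p := by
    obtain ⟨j, m, hm⟩ := p
    refine Prod.ext (by simp [hm]) (Subtype.ext ?_)
    change (m + Finsupp.single i j).erase i = m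
    rw [Finsupp.erase_add, Finsupp.erase_single, add_zero,
      Finsupp.erase_of_notMem_support (by simpa using hm)]

lemma tsum_occWeight_mul {q : ι → ℝ} (h0 : ∀ k, 0 ≤ q k) (h1 : ∀ k, q k < 1)
    (hs : Summable fun k => q k / (1 - q k)) (i : ι) (g : ℕ → ℂ) {C : ℝ}
    (hg : ∀ j, ‖g j‖ ≤ C) :
    ∑' n : ι →₀ ℕ, (occWeight q n : ℂ) * g (n i)
      = (∑' j : ℕ, (q i : ℂ) ^ j * g j) *
        ∑' m : {m : ι →₀ ℕ // m i = 0}, (occWeight q m.1 : ℂ) := by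
  have hw := summable_occWeight h0 h1 hs
  have hj : Summable fun j : ℕ => ‖(q i : ℂ) ^ j * g j‖ := by
    refine Summable.of_nonneg_of_le (fun j => norm_nonneg _) (fun j => ?_)
      ((summable_geometric_of_lt_one (h0 i) (h1 i)).mul_right C)
    rw [norm_mul, norm_pow, Complex.norm_real, Real.norm_of_nonneg (h0 i)]
    exact mul_le_mul_of_nonneg_left (hg j) (pow_nonneg (h0 i) j)
  have hm : Summable fun m : {m : ι →₀ ℕ // m i = 0} => ‖(occWeight q m.1 : ℂ)‖ := by
    refine (hw.comp_injective Subtype.val_injective).congr fun m => ?_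
    rw [Complex.norm_real, Real.norm_of_nonneg (occWeight_nonneg h0 _)]
    rfl
  rw [tsum_mul_tsum_of_summable_norm hj hm, ← (splitMode i).symm.tsum_eq]
  refine tsum_congr fun p => ?_
  obtain ⟨j, m, hm⟩ := p
  have e : (splitMode i).symm (j, ⟨m, hm⟩) = m + Finsupp.single i j := rfl
  rw [e, occWeight_add_single]
  simp only [Finsupp.add_apply, hm, Finsupp.single_eq_same, zero_add]
  push_cast
  ring

/-- The occupation of mode `i` is geometrically distributed: the sum over the other modes factors
out of numerator and denominator and cancels, being at least the vacuum weight `1`. -/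
lemma gibbsState_of_diagonal {h : ι → ℝ} {β μ : ℝ}
    (h1 : ∀ k, Real.exp (-β * (h k - μ)) < 1)
    (hs : Summable fun k => Real.exp (-β * (h k - μ)) / (1 - Real.exp (-β * (h k - μ))))
    (i : ι) (A : Fock ι →L[ℂ] Fock ι) (g : ℕ → ℂ) {C : ℝ} (hg : ∀ j, ‖g j‖ ≤ C)
    (hA : ∀ n, inner ℂ (occ n) (A (occ n)) = g (n i)) :
    gibbsState h β μ A = ∑' j : ℕ, ((1 - Real.exp (-β * (h i - μ))) *
      Real.exp (-β * (h i - μ)) ^ j : ℝ) • g j := by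
  unfold gibbsState
  set q : ι → ℝ := fun k => Real.exp (-β * (h k - μ)) with hq
  have h0 : ∀ k, 0 ≤ q k := fun k => (Real.exp_pos _).le
  have hn := tsum_occWeight_mul h0 h1 hs i g hg
  have hd := tsum_occWeight_mul h0 h1 hs i (fun _ => 1) (C := 1) (by simp)
  simp only [mul_one] at hd
  have hZ : ∑' m : {m : ι →₀ ℕ // m i = 0}, (occWeight q m.1 : ℂ) ≠ 0 := by
    have hw := (summable_occWeight h0 h1 hs).comp_injective
      (Subtype.val_injective (p := fun m : ι →₀ ℕ => m i = 0))
    have h2 := hw.le_tsum ⟨0, rfl⟩ fun m _ => occWeight_nonneg h0 _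
    have h3 : occWeight q 0 = 1 := by simp [occWeight]
    simp only [Function.comp_apply, h3] at h2
    rw [← Complex.ofReal_tsum]
    exact_mod_cast (lt_of_lt_of_le one_pos h2).ne'
  have hgeo : ∑' j : ℕ, (q i : ℂ) ^ j = (1 - (q i : ℂ))⁻¹ :=
    tsum_geometric_of_norm_lt_one (by
      rw [Complex.norm_real, Real.norm_of_nonneg (h0 i)]; exact h1 i)
  have hq1 : (1 - (q i : ℂ)) ≠ 0 := by
    rw [sub_ne_zero]
    exact_mod_cast (h1 i).ne'
  rw [gibbsWeight_eq_occWeight]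
  simp only [hA]
  rw [hn, hd, hgeo, mul_div_mul_right _ _ hZ, div_inv_eq_mul, mul_comm, ← tsum_mul_left]
  refine tsum_congr fun j => ?_
  change _ = ((1 - q i) * q i ^ j : ℝ) • g j
  rw [Complex.real_smul]
  push_cast
  ring

end Gibbs

/-! ### Expectation values of the resolvent -/

lemma norm_hermiteResolvent_le (a : ℝ) (j : ℕ) : ‖hermiteResolvent a j j‖ ≤ 1 := by
  unfold hermiteResolvent
  have hi : Integrable (fun x => (hermiteNormed j).eval x ^ 2) stdGaussianReal := by
    have := integrable_eval_stdGaussianReal (hermiteNormed j ^ 2)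
    simpa only [Polynomial.eval_pow] using this
  rw [← integral_hermiteNormed_sq j]
  refine norm_integral_le_of_norm_le hi (Eventually.of_forall fun x => ?_)
  rw [norm_mul, Complex.norm_real, ← sq, Real.norm_of_nonneg (sq_nonneg _)]
  exact mul_le_of_le_one_right (sq_nonneg _) (norm_inv_I_sub_ofReal_le _)

/-- The expectation of `1 / (1 + v x²)` for a standard Gaussian `x`. -/
noncomputable def gaussianLorentz (v : ℝ) : ℝ := ∫ x, 1 / (1 + v * x ^ 2) ∂stdGaussianReal

lemma I_mul_inv_I_sub (r : ℝ) : Complex.I * (Complex.I - (r : ℂ))⁻¹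
    = ((1 / (1 + r ^ 2) : ℝ) : ℂ) - Complex.I * ((r / (1 + r ^ 2) : ℝ) : ℂ) := by
  have h1 := I_sub_ofReal_ne_zero r
  have h2 : (1 + (r : ℂ) ^ 2) ≠ 0 := by
    have : (1 + r ^ 2 : ℝ) ≠ 0 := by positivity
    exact_mod_cast this
  push_cast
  rw [← div_eq_mul_inv, div_eq_iff h1, eq_comm, mul_comm, ← mul_right_inj' h2]
  field_simp
  linear_combination (-(r : ℂ)) * Complex.I_sq

/-- Rescale to unit variance and split `i/(i - r)` into `1/(1+r²)` and an imaginary part odd in `r`,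
which integrates to zero by reflection. -/
lemma integral_inv_I_sub_gaussianReal (a : ℝ) {v : ℝ} (hv : 0 ≤ v) :
    Complex.I * ∫ x : ℝ, (Complex.I - ((a * x : ℝ) : ℂ))⁻¹ ∂gaussianReal 0 v.toNNReal
      = gaussianLorentz (a ^ 2 * v) := by
  have hmap : gaussianReal 0 v.toNNReal = stdGaussianReal.map (√v * ·) := by
    rw [stdGaussianReal, gaussianReal_map_const_mul, mul_zero, mul_one]
    congr 1
    ext
    simp [Real.sq_sqrt hv, hv]
  rw [hmap, integral_map (by fun_prop) (continuous_inv_I_sub a).aestronglyMeasurable,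
    ← integral_const_mul]
  simp only [I_mul_inv_I_sub]
  have hsq : ∀ x : ℝ, (a * (√v * x)) ^ 2 = a ^ 2 * v * x ^ 2 := fun x => by
    rw [mul_pow, mul_pow, Real.sq_sqrt hv]; ring
  simp only [hsq]
  have hp : ∀ x : ℝ, 0 < 1 + a ^ 2 * v * x ^ 2 := fun x => by positivity
  have i1 : Integrable (fun x : ℝ => 1 / (1 + a ^ 2 * v * x ^ 2)) stdGaussianReal := by
    refine Integrable.of_bound (C := 1) (Continuous.aestronglyMeasurable
      (continuous_const.div (by fun_prop) fun x => (hp x).ne')) (Eventually.of_forall fun x => ?_)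
    rw [Real.norm_of_nonneg (by positivity), div_le_one (hp x)]
    have : 0 ≤ a ^ 2 * v * x ^ 2 := by positivity
    linarith
  have i2 : Integrable (fun x : ℝ => a * (√v * x) / (1 + a ^ 2 * v * x ^ 2))
      stdGaussianReal := by
    refine Integrable.of_bound (C := 1) (Continuous.aestronglyMeasurable
      (Continuous.div (by fun_prop) (by fun_prop) fun x => (hp x).ne'))
      (Eventually.of_forall fun x => ?_)
    rw [norm_div, Real.norm_of_nonneg (hp x).le, div_le_one (hp x), ← hsq, Real.norm_eq_abs,
      ← sq_abs]
    nlinarith [sq_nonneg (|a * (√v * x)| - 1), sq_nonneg |a * (√v * x)|]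
  have hodd : ∫ x : ℝ, a * (√v * x) / (1 + a ^ 2 * v * x ^ 2) ∂stdGaussianReal = 0 := by
    have hn : stdGaussianReal.map (fun x => -x) = stdGaussianReal := by
      rw [stdGaussianReal, gaussianReal_map_neg, neg_zero]
    have h := integral_map (μ := stdGaussianReal) (φ := fun x : ℝ => -x) (by fun_prop)
      (f := fun x : ℝ => a * (√v * x) / (1 + a ^ 2 * v * x ^ 2))
      (by rw [hn]; exact i2.aestronglyMeasurable)
    rw [hn] at h
    have e : ∀ x : ℝ, a * (√v * -x) / (1 + a ^ 2 * v * (-x) ^ 2)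
        = -(a * (√v * x) / (1 + a ^ 2 * v * x ^ 2)) := fun x => by
      rw [neg_sq, ← neg_div]; congr 1; ring
    simp only [e, integral_neg] at h
    linarith
  rw [integral_sub (by exact_mod_cast i1.ofReal (𝕜 := ℂ))
    (by exact (Integrable.ofReal (𝕜 := ℂ) i2).const_mul _), integral_const_mul,
    integral_complex_ofReal, integral_complex_ofReal, hodd]
  simp [gaussianLorentz]

lemma I_mul_gibbsState_resolvent {ι : Type} [DecidableEq ι] {h : ι → ℝ} {β μ : ℝ}
    (h1 : ∀ k, Real.exp (-β * (h k - μ)) < 1)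
    (hs : Summable fun k => Real.exp (-β * (h k - μ)) / (1 - Real.exp (-β * (h k - μ))))
    (i : ι) (c : ℝ) :
    Complex.I * gibbsState h β μ (resolvent 1 (Pi.single i (c : ℂ)))
      = gaussianLorentz (c ^ 2 / 2 *
        ((1 + Real.exp (-β * (h i - μ))) / (1 - Real.exp (-β * (h i - μ))))) := by
  rw [gibbsState_of_diagonal h1 hs i _ (fun j => hermiteResolvent (c / √2) j j)
    (norm_hermiteResolvent_le _) (inner_occ_resolvent c i)]
  have hq0 : 0 ≤ Real.exp (-β * (h i - μ)) := (Real.exp_pos _).le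
  have hq1 := h1 i
  set q := Real.exp (-β * (h i - μ))
  have hsum := hasSum_integral_thermalMeasure hq0 hq1 (continuous_inv_I_sub (c / √2)) (C := 1)
    fun x => (norm_inv_I_sub_ofReal_le _).trans (by nlinarith [sq_nonneg x])
  have e : ∀ j : ℕ, hermiteResolvent (c / √2) j j = ∫ x : ℝ, (hermiteNormed j).eval x ^ 2 •
      (Complex.I - ((c / √2 * x : ℝ) : ℂ))⁻¹ ∂stdGaussianReal := by
    intro j
    unfold hermiteResolvent
    simp only [← sq, Complex.real_smul]
  simp only [e]
  rw [hsum.tsum_eq, thermalMeasure_eq_gaussianReal hq0 hq1, integral_inv_I_sub_gaussianReal _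
    (div_nonneg (by linarith) (by linarith)), div_pow, Real.sq_sqrt (by norm_num)]

/-! ### The order parameter of the box -/

lemma momentum_apply (d : ℕ) (L : ℝ) (m : Fin d → ℤ) (i : Fin d) :
    momentum d L m i = 2 * Real.pi / L * (m i : ℝ) := rfl

lemma setIntegral_exp_momentum {L : ℝ} (hL : 0 < L) (k : ℤ) :
    ∫ x in Set.Icc (-(L / 2)) (L / 2), Complex.exp (-Complex.I * ((2 * Real.pi / L * k * x : ℝ) : ℂ))
      = if k = 0 then (L : ℂ) else 0 := by
  rw [integral_Icc_eq_integral_Ioc, ← intervalIntegral.integral_of_le (by linarith)]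
  split_ifs with hk
  · subst hk
    simp
  · have hc : -Complex.I * ((2 * Real.pi / L * k : ℝ) : ℂ) ≠ 0 := by
      refine mul_ne_zero (neg_ne_zero.mpr Complex.I_ne_zero) ?_
      rw [Complex.ofReal_ne_zero]
      have : (k : ℝ) ≠ 0 := by exact_mod_cast hk
      positivity
    have e : ∀ x : ℝ, Complex.exp (-Complex.I * ((2 * Real.pi / L * k * x : ℝ) : ℂ))
        = Complex.exp (-Complex.I * ((2 * Real.pi / L * k : ℝ) : ℂ) * x) := fun x => by
      push_cast
      ring_nf
    simp only [e]
    rw [integral_exp_mul_complex hc, div_eq_zero_iff]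
    left
    rw [sub_eq_zero, Complex.exp_eq_exp_iff_exists_int]
    refine ⟨-k, ?_⟩
    have hL' : (L : ℂ) ≠ 0 := by exact_mod_cast hL.ne'
    push_cast
    field_simp
    ring

/-- Nonzero Fourier modes are orthogonal to constants. At `m = 0` the integral gives a factor `V`,
and the exponents add up to `-1/2 + 1 - (1+a)/2 = -a/2`. -/
lemma modeCoeff_boxFun (d : ℕ) {L : ℝ} (hL : 0 < L) (a : ℝ) :
    modeCoeff d L (boxFun d L a) = Pi.single 0 (((L ^ d) ^ (-(a / 2)) : ℝ) : ℂ) := by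
  have hV : 0 < L ^ d := pow_pos hL d
  funext m
  have h1 : ∫ x in box d L, Complex.exp (-Complex.I * ((∑ i, momentum d L m i * x i : ℝ) : ℂ))
      * boxFun d L a x
      = (∫ x in box d L, ∏ i, Complex.exp (-Complex.I * ((2 * Real.pi / L * m i * x i : ℝ) : ℂ)))
        * (((L ^ d) ^ (-((1 + a) / 2)) : ℝ) : ℂ) := by
    rw [← integral_mul_const]
    refine setIntegral_congr_fun (MeasurableSet.univ_pi fun _ => measurableSet_Icc) fun x hx => ?_
    simp only [boxFun]
    rw [Set.indicator_of_mem hx, ← Complex.exp_sum, ← Finset.mul_sum]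
    simp only [momentum_apply]
    push_cast
    rfl
  have h2 : ∫ x in box d L, ∏ i, Complex.exp (-Complex.I * ((2 * Real.pi / L * m i * x i : ℝ) : ℂ))
      = ∏ i, (if m i = 0 then (L : ℂ) else 0) := by
    unfold box
    rw [volume_pi, Measure.restrict_pi_pi, integral_fintype_prod_eq_prod (𝕜 := ℂ)
      (f := fun i (x : ℝ) => Complex.exp (-Complex.I * ((2 * Real.pi / L * m i * x : ℝ) : ℂ)))]
    exact Finset.prod_congr rfl fun i _ => setIntegral_exp_momentum hL (m i)
  unfold modeCoeff
  rw [h1, h2]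
  by_cases hm : m = 0
  · subst hm
    simp only [Pi.zero_apply, if_true, Finset.prod_const, Finset.card_univ, Fintype.card_fin,
      Pi.single_eq_same]
    rw [← Complex.ofReal_pow, ← Complex.ofReal_mul, ← Complex.ofReal_mul]
    congr 1
    nth_rewrite 2 [← Real.rpow_one (L ^ d)]
    rw [← Real.rpow_add hV, ← Real.rpow_add hV]
    congr 1
    ring
  · obtain ⟨i, hi⟩ : ∃ i, m i ≠ 0 := by
      by_contra! h
      exact hm (funext h)
    rw [Pi.single_eq_of_ne hm, Finset.prod_eq_zero (Finset.mem_univ i) (if_neg hi)]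
    simp

lemma energy_zero (d : ℕ) {s : ℝ} (hs : 0 < s) (L : ℝ) : energy d s L 0 = 0 := by
  have : momentum d L 0 = 0 := by
    ext i
    simp [momentum_apply]
  unfold energy dispersion
  rw [this, norm_zero, Real.zero_rpow hs.ne']

lemma energy_nonneg (d : ℕ) (s L : ℝ) (m : Fin d → ℤ) : 0 ≤ energy d s L m :=
  Real.rpow_nonneg (norm_nonneg _) _

lemma boltzmann_eq {β y : ℝ} (hβ : 0 < β) (hy : 0 < y) (e : ℝ) :
    Real.exp (-β * (e - -Real.log y / β)) = (y * Real.exp (β * e))⁻¹ := by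
  have : -β * (e - -Real.log y / β) = -(Real.log y + β * e) := by
    field_simp
    ring
  rw [this, Real.exp_neg, Real.exp_add, Real.exp_log hy]

/-- The order parameter in a finite box is an explicit Gaussian expectation. -/
lemma boxOrder_eq {d : ℕ} {s β ρ L : ℝ} (hs : 0 < s) (hβ : 0 < β) (hL : 0 < L)
    (hy : 1 < yBox d s β ρ L)
    (hsum : Summable fun m : Fin d → ℤ =>
      1 / (yBox d s β ρ L * Real.exp (β * energy d s L m) - 1)) (a : ℝ) :
    boxOrder d s β ρ a L
      = gaussianLorentz ((L ^ d) ^ (-a) * (1 / 2 + 1 / (yBox d s β ρ L - 1))) := by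
  have hV : 0 < L ^ d := pow_pos hL d
  unfold boxOrder chemPot
  set y := yBox d s β ρ L
  have hy0 : 0 < y := one_pos.trans hy
  have hq := boltzmann_eq hβ hy0
  have h1 : ∀ m : Fin d → ℤ, 1 < y * Real.exp (β * energy d s L m) := fun m =>
    one_lt_mul_of_lt_of_le hy (Real.one_le_exp (mul_nonneg hβ.le (energy_nonneg d s L m)))
  rw [modeCoeff_boxFun d hL, I_mul_gibbsState_resolvent]
  · rw [hq, energy_zero d hs, mul_zero, Real.exp_zero, mul_one]
    congr 2
    rw [← Real.rpow_natCast, ← Real.rpow_mul hV.le]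
    have e : -(a / 2) * ((2 : ℕ) : ℝ) = -a := by push_cast; ring
    rw [e]
    have h2 : y - 1 ≠ 0 := by linarith
    have h3 : 1 - y⁻¹ ≠ 0 := by
      have := inv_lt_one_of_one_lt₀ hy
      linarith
    field_simp
    ring
  · intro m
    rw [hq]
    exact inv_lt_one_of_one_lt₀ (h1 m)
  · refine hsum.congr fun m => ?_
    rw [hq]
    have h2 := h1 m
    set w := y * Real.exp (β * energy d s L m)
    have h3 : w - 1 ≠ 0 := by linarith
    have h4 : 1 - w⁻¹ ≠ 0 := by
      have := inv_lt_one_of_one_lt₀ h2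
      linarith
    have h5 : w ≠ 0 := by linarith
    field_simp

/-! ### Limits of the Gaussian expectation -/

lemma continuous_lorentz {v : ℝ} (hv : 0 ≤ v) : Continuous fun x : ℝ => 1 / (1 + v * x ^ 2) :=
  continuous_const.div (by fun_prop) fun x => by positivity

lemma norm_lorentz_le {v : ℝ} (hv : 0 ≤ v) (x : ℝ) : ‖1 / (1 + v * x ^ 2)‖ ≤ 1 := by
  rw [Real.norm_of_nonneg (by positivity), div_le_one (by positivity)]
  have : 0 ≤ v * x ^ 2 := by positivity
  linarith

lemma integrable_lorentz {v : ℝ} (hv : 0 ≤ v) :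
    Integrable (fun x : ℝ => 1 / (1 + v * x ^ 2)) stdGaussianReal :=
  Integrable.of_bound (C := 1) (continuous_lorentz hv).aestronglyMeasurable
    (Eventually.of_forall (norm_lorentz_le hv))

lemma gaussianLorentz_zero : gaussianLorentz 0 = 1 := by simp [gaussianLorentz]

lemma gaussianLorentz_mem_Icc {v : ℝ} (hv : 0 ≤ v) : gaussianLorentz v ∈ Set.Icc (0 : ℝ) 1 := by
  refine ⟨integral_nonneg fun x => by positivity, ?_⟩
  have h := integral_mono (integrable_lorentz hv) (integrable_const (1 : ℝ))
    fun x => (Real.le_norm_self _).trans (norm_lorentz_le hv x)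
  simpa [gaussianLorentz] using h

lemma gaussianLorentz_pos {v : ℝ} (hv : 0 ≤ v) : 0 < gaussianLorentz v := by
  unfold gaussianLorentz
  rw [integral_pos_iff_support_of_nonneg (fun x => by positivity) (integrable_lorentz hv)]
  have : (Function.support fun x : ℝ => 1 / (1 + v * x ^ 2)) = Set.univ := by
    ext x
    simp only [Function.mem_support, Set.mem_univ, iff_true]
    positivity
  rw [this]
  simp

lemma ae_ne_zero_stdGaussianReal : ∀ᵐ x ∂stdGaussianReal, x ≠ 0 := by
  refine (gaussianReal_absolutelyContinuous 0 one_ne_zero).ae_le ?_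
  exact Measure.ae_ne volume 0

lemma gaussianLorentz_lt_one {v : ℝ} (hv : 0 < v) : gaussianLorentz v < 1 := by
  have hi := (integrable_const (1 : ℝ) (μ := stdGaussianReal)).sub (integrable_lorentz hv.le)
  have h0 : ∀ x : ℝ, 0 ≤ 1 - 1 / (1 + v * x ^ 2) := fun x =>
    sub_nonneg.mpr ((Real.le_norm_self _).trans (norm_lorentz_le hv.le x))
  have h : 0 < ∫ x : ℝ, (1 - 1 / (1 + v * x ^ 2)) ∂stdGaussianReal := by
    rw [integral_pos_iff_support_of_nonneg h0 hi]
    have : ∀ᵐ x ∂stdGaussianReal, x ∈ Function.support fun x : ℝ => 1 - 1 / (1 + v * x ^ 2) := by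
      filter_upwards [ae_ne_zero_stdGaussianReal] with x hx
      rw [Function.mem_support]
      refine ne_of_gt ?_
      have : 0 < v * x ^ 2 := by positivity
      rw [sub_pos, div_lt_one (by positivity)]
      linarith
    refine lt_of_lt_of_eq one_pos ?_
    rw [← measure_univ (μ := stdGaussianReal)]
    exact (measure_congr (eventuallyEq_univ.mpr this)).symm
  rw [integral_sub (integrable_const _) (integrable_lorentz hv.le)] at h
  simp only [integral_const, probReal_univ, smul_eq_mul, mul_one] at h
  unfold gaussianLorentz
  linarith

lemma tendsto_gaussianLorentz {α : Type*} {l : Filter α} [l.IsCountablyGenerated] {u : α → ℝ}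
    (hu : ∀ᶠ t in l, 0 ≤ u t) {v : ℝ} (hv : 0 ≤ v) (h : Tendsto u l (𝓝 v)) :
    Tendsto (fun t => gaussianLorentz (u t)) l (𝓝 (gaussianLorentz v)) := by
  refine tendsto_integral_filter_of_dominated_convergence (fun _ => 1) ?_ ?_
    (integrable_const _) (Eventually.of_forall fun x => ?_)
  · filter_upwards [hu] with t ht using (continuous_lorentz ht).aestronglyMeasurable
  · filter_upwards [hu] with t ht using Eventually.of_forall (norm_lorentz_le ht)
  · exact tendsto_const_nhds.div (tendsto_const_nhds.add (h.mul_const _)) (by positivity)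

lemma tendsto_gaussianLorentz_atTop {α : Type*} {l : Filter α} [l.IsCountablyGenerated]
    {u : α → ℝ} (h : Tendsto u l atTop) :
    Tendsto (fun t => gaussianLorentz (u t)) l (𝓝 0) := by
  have hu := h.eventually_ge_atTop 0
  have h0 : (0 : ℝ) = ∫ _, (0 : ℝ) ∂stdGaussianReal := by simp
  rw [h0]
  refine tendsto_integral_filter_of_dominated_convergence (fun _ => 1) ?_ ?_
    (integrable_const _) ?_
  · filter_upwards [hu] with t ht using (continuous_lorentz ht).aestronglyMeasurable
  · filter_upwards [hu] with t ht using Eventually.of_forall (norm_lorentz_le ht)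
  · filter_upwards [ae_ne_zero_stdGaussianReal] with x hx
    exact tendsto_const_nhds.div_atTop (tendsto_atTop_add_const_left _ _
      (h.atTop_mul_const (by positivity)))

/-! ### The Bose distribution function -/

/-- The Bose distribution `1 / (y exp(β rˢ) - 1)`. -/
noncomputable def bose (β s y r : ℝ) : ℝ := 1 / (y * Real.exp (β * r ^ s) - 1)

lemma one_le_exp_mul_rpow {β r : ℝ} (hβ : 0 < β) (hr : 0 ≤ r) (s : ℝ) :
    1 ≤ Real.exp (β * r ^ s) :=
  Real.one_le_exp (mul_nonneg hβ.le (Real.rpow_nonneg hr s))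

lemma bose_nonneg {β y r : ℝ} (hβ : 0 < β) (hy : 1 ≤ y) (hr : 0 ≤ r) (s : ℝ) :
    0 ≤ bose β s y r := by
  have h := one_le_exp_mul_rpow hβ hr s
  exact div_nonneg zero_le_one (by nlinarith)

lemma bose_den_pos {β s y r : ℝ} (hβ : 0 < β) (hy : 1 ≤ y) (hr : 0 ≤ r)
    (h : 1 < y ∨ 0 < r) : 0 < y * Real.exp (β * r ^ s) - 1 := by
  have h1 := one_le_exp_mul_rpow hβ hr s
  rcases h with h | h
  · nlinarith
  · have h2 : 1 < Real.exp (β * r ^ s) :=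
      Real.one_lt_exp_iff.mpr (mul_pos hβ (Real.rpow_pos_of_pos h s))
    nlinarith

/-- `y/(yE - 1) = 1/(E - 1/y)` decreases in `y`. Together with the growth of `(y-1)/(yE-1)` for `E ≥
1`, this passes termwise to sums and integrals, and the two monotonicities yield continuity and
solvability in `y` without differentiation. -/
lemma mul_bose_le {β s y y' r : ℝ} (hβ : 0 < β) (hy' : 1 ≤ y') (hy : y' ≤ y) (hr : 0 ≤ r)
    (h : 1 < y' ∨ 0 < r) : y * bose β s y r ≤ y' * bose β s y' r := by
  have h1 := bose_den_pos (s := s) hβ hy' hr h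
  have h2 := bose_den_pos (s := s) hβ (hy'.trans hy) hr (h.imp_left fun h => h.trans_le hy)
  unfold bose
  rw [mul_one_div, mul_one_div, div_le_div_iff₀ h2 h1]
  nlinarith

lemma sub_one_mul_bose_le {β s y y' r : ℝ} (hβ : 0 < β) (hy' : 1 < y') (hy : y' ≤ y)
    (hr : 0 ≤ r) : (y' - 1) * bose β s y' r ≤ (y - 1) * bose β s y r := by
  have h1 := bose_den_pos (s := s) hβ hy'.le hr (Or.inl hy')
  have h2 := bose_den_pos (s := s) hβ (hy'.le.trans hy) hr (Or.inl (hy'.trans_le hy))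
  have h3 := one_le_exp_mul_rpow hβ hr s
  unfold bose
  rw [mul_one_div, mul_one_div, div_le_div_iff₀ h1 h2]
  nlinarith [mul_nonneg (sub_nonneg.mpr hy) (sub_nonneg.mpr h3)]

lemma bose_anti_left {β s y y' r : ℝ} (hβ : 0 < β) (hy' : 1 ≤ y') (hy : y' ≤ y) (hr : 0 ≤ r)
    (h : 1 < y' ∨ 0 < r) : bose β s y r ≤ bose β s y' r := by
  have h3 := one_le_exp_mul_rpow hβ hr s
  refine one_div_le_one_div_of_le (bose_den_pos (s := s) hβ hy' hr h) ?_
  nlinarith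

lemma bose_anti_right {β s y r r' : ℝ} (hβ : 0 < β) (hs : 0 < s) (hy : 1 ≤ y) (hr' : 0 ≤ r')
    (hr : r' ≤ r) (h : 1 < y ∨ 0 < r') : bose β s y r ≤ bose β s y r' := by
  refine one_div_le_one_div_of_le (bose_den_pos (s := s) hβ hy hr' h) ?_
  have : Real.exp (β * r' ^ s) ≤ Real.exp (β * r ^ s) := Real.exp_le_exp.mpr
    (mul_le_mul_of_nonneg_left (Real.rpow_le_rpow hr' hr hs.le) hβ.le)
  nlinarith

lemma bose_le_exp {β s y r : ℝ} (hβ : 0 < β) (hy : 1 < y) (hr : 0 ≤ r) :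
    bose β s y r ≤ (y - 1)⁻¹ * Real.exp (-β * r ^ s) := by
  have h1 := bose_den_pos (s := s) hβ hy.le hr (Or.inl hy)
  have h3 := one_le_exp_mul_rpow hβ hr s
  rw [neg_mul, Real.exp_neg, ← mul_inv]
  unfold bose
  rw [one_div]
  refine inv_anti₀ (mul_pos (by linarith) (Real.exp_pos _)) ?_
  nlinarith

lemma measurable_bose (β s y : ℝ) : Measurable (bose β s y) := by
  unfold bose
  fun_prop

lemma tendsto_bose {α : Type*} {l : Filter α} {β s y r : ℝ} (hβ : 0 < β) (hs : 0 < s)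
    (hy : 1 ≤ y) (hr : 0 ≤ r) (h : 1 < y ∨ 0 < r) {Y R : α → ℝ} (hY : Tendsto Y l (𝓝 y))
    (hR : Tendsto R l (𝓝 r)) : Tendsto (fun t => bose β s (Y t) (R t)) l (𝓝 (bose β s y r)) := by
  unfold bose
  refine tendsto_const_nhds.div ?_ (bose_den_pos (s := s) hβ hy hr h).ne'
  refine (hY.mul ?_).sub tendsto_const_nhds
  exact (Real.continuous_exp.tendsto _).comp ((hR.rpow_const (Or.inr hs.le)).const_mul β)

/-! ### The density of the ideal gas in infinite volume -/

/-- The infinite-volume density `(2π)^(-d) ∫ dk / (y exp(β |k|ˢ) - 1)`. -/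
noncomputable def idealDensity (d : ℕ) (s β y : ℝ) : ENNReal :=
  ENNReal.ofReal (((2 * Real.pi) ^ d)⁻¹) *
    ∫⁻ k : EuclideanSpace ℝ (Fin d), ENNReal.ofReal (bose β s y ‖k‖)

lemma criticalDensity_eq (d : ℕ) (s β : ℝ) : criticalDensity d s β = idealDensity d s β 1 := by
  simp only [criticalDensity, idealDensity, bose, dispersion, one_mul]

lemma measurable_bose_norm (d : ℕ) (s β y : ℝ) :
    Measurable fun k : EuclideanSpace ℝ (Fin d) => ENNReal.ofReal (bose β s y ‖k‖) :=
  ((measurable_bose β s y).comp measurable_norm).ennreal_ofReal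

lemma ofReal_two_pi_pow_ne_zero (d : ℕ) : ENNReal.ofReal (((2 * Real.pi) ^ d)⁻¹) ≠ 0 := by
  have : 0 < ((2 * Real.pi) ^ d)⁻¹ := by positivity
  simpa using this

lemma idealDensity_ne_top_iff {d : ℕ} {s β y : ℝ} : idealDensity d s β y ≠ ⊤ ↔
    ∫⁻ k : EuclideanSpace ℝ (Fin d), ENNReal.ofReal (bose β s y ‖k‖) ≠ ⊤ := by
  unfold idealDensity
  rw [Ne, ENNReal.mul_eq_top]
  have := ofReal_two_pi_pow_ne_zero d
  simp [this]

lemma integrable_exp_neg_norm_rpow {d : ℕ} (hd : 1 ≤ d) {s β : ℝ} (hs : 0 < s) (hβ : 0 < β) :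
    Integrable fun k : EuclideanSpace ℝ (Fin d) => Real.exp (-β * ‖k‖ ^ s) := by
  have hf : Module.finrank ℝ (EuclideanSpace ℝ (Fin d)) = d := finrank_euclideanSpace_fin
  have : Nontrivial (EuclideanSpace ℝ (Fin d)) :=
    Module.nontrivial_of_finrank_pos (R := ℝ) (by omega)
  rw [integrable_fun_norm_addHaar volume (f := fun r => Real.exp (-β * r ^ s))]
  have h := integrableOn_rpow_mul_exp_neg_mul_rpow (p := s) (s := ((d - 1 : ℕ) : ℝ))
    (by have : (0 : ℝ) ≤ ((d - 1 : ℕ) : ℝ) := Nat.cast_nonneg _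
        linarith) hs hβ
  simpa only [hf, Real.rpow_natCast, smul_eq_mul] using h

lemma idealDensity_ne_top {d : ℕ} (hd : 1 ≤ d) {s β y : ℝ} (hs : 0 < s) (hβ : 0 < β)
    (hy : 1 < y) : idealDensity d s β y ≠ ⊤ := by
  rw [idealDensity_ne_top_iff]
  have h := ((integrable_exp_neg_norm_rpow hd hs hβ).const_mul (y - 1)⁻¹).lintegral_lt_top
  exact ((lintegral_mono fun k => ENNReal.ofReal_le_ofReal
    (bose_le_exp hβ hy (norm_nonneg k))).trans_lt h).ne

lemma ae_norm_pos {d : ℕ} (hd : 1 ≤ d) : ∀ᵐ k : EuclideanSpace ℝ (Fin d), 0 < ‖k‖ := by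
  have hf : Module.finrank ℝ (EuclideanSpace ℝ (Fin d)) = d := finrank_euclideanSpace_fin
  have : Nontrivial (EuclideanSpace ℝ (Fin d)) :=
    Module.nontrivial_of_finrank_pos (R := ℝ) (by omega)
  filter_upwards [Measure.ae_ne volume 0] with k hk using norm_pos_iff.mpr hk

lemma mul_idealDensity_le {d : ℕ} (hd : 1 ≤ d) {s β y y' : ℝ} (hβ : 0 < β) (hy' : 1 ≤ y')
    (hy : y' ≤ y) :
    ENNReal.ofReal y * idealDensity d s β y ≤ ENNReal.ofReal y' * idealDensity d s β y' := by
  unfold idealDensity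
  rw [mul_left_comm, mul_left_comm (ENNReal.ofReal y')]
  refine mul_le_mul_right ?_ _
  rw [← lintegral_const_mul _ (measurable_bose_norm _ _ _ _),
    ← lintegral_const_mul _ (measurable_bose_norm _ _ _ _)]
  refine lintegral_mono_ae ?_
  filter_upwards [ae_norm_pos hd] with k hk
  rw [← ENNReal.ofReal_mul (by linarith), ← ENNReal.ofReal_mul (by linarith)]
  exact ENNReal.ofReal_le_ofReal (mul_bose_le hβ hy' hy hk.le (Or.inr hk))

lemma sub_one_mul_idealDensity_le {d : ℕ} {s β y y' : ℝ} (hβ : 0 < β)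
    (hy' : 1 < y') (hy : y' ≤ y) :
    ENNReal.ofReal (y' - 1) * idealDensity d s β y'
      ≤ ENNReal.ofReal (y - 1) * idealDensity d s β y := by
  unfold idealDensity
  rw [mul_left_comm, mul_left_comm (ENNReal.ofReal (y - 1))]
  refine mul_le_mul_right ?_ _
  rw [← lintegral_const_mul _ (measurable_bose_norm _ _ _ _),
    ← lintegral_const_mul _ (measurable_bose_norm _ _ _ _)]
  refine lintegral_mono fun k => ?_
  rw [← ENNReal.ofReal_mul (by linarith), ← ENNReal.ofReal_mul (by linarith)]
  exact ENNReal.ofReal_le_ofReal (sub_one_mul_bose_le hβ hy' hy (norm_nonneg k))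

/-- The infinite-volume density tends to the critical density as `y ↓ 1`. -/
lemma tendsto_idealDensity_one {d : ℕ} (hd : 1 ≤ d) {s β : ℝ} (hs : 0 < s) (hβ : 0 < β) :
    Tendsto (fun n : ℕ => idealDensity d s β (1 + 1 / ((n : ℝ) + 1))) atTop
      (𝓝 (idealDensity d s β 1)) := by
  refine ENNReal.Tendsto.const_mul ?_ (Or.inr ENNReal.ofReal_ne_top)
  -- Monotone convergence, since the critical density may be infinite.
  refine lintegral_tendsto_of_tendsto_of_monotone
    (fun n => (measurable_bose_norm _ _ _ _).aemeasurable) ?_ ?_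
  · filter_upwards [ae_norm_pos hd] with k hk m n hmn
    have h1 : (0 : ℝ) < 1 / ((n : ℝ) + 1) := by positivity
    have h2 : 1 / ((n : ℝ) + 1) ≤ 1 / ((m : ℝ) + 1) := one_div_le_one_div_of_le (by positivity)
      (by have : (m : ℝ) ≤ n := by exact_mod_cast hmn
          linarith)
    exact ENNReal.ofReal_le_ofReal (bose_anti_left hβ (by linarith) (by linarith) hk.le
      (Or.inr hk))
  · filter_upwards [ae_norm_pos hd] with k hk
    refine ENNReal.tendsto_ofReal (tendsto_bose hβ hs le_rfl hk.le (Or.inr hk) ?_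
      tendsto_const_nhds)
    simpa using (tendsto_const_nhds (x := (1 : ℝ))).add tendsto_one_div_add_atTop_nhds_zero_nat

/-! ### Lattice sums as integrals of step functions -/

/-- The integer part of a vector, coordinate by coordinate. -/
noncomputable def floorVec {d : ℕ} (x : EuclideanSpace ℝ (Fin d)) : Fin d → ℤ := fun i => ⌊x i⌋

/-- The point `t m` of the lattice `t ℤᵈ`. -/
noncomputable def latticePoint {d : ℕ} (t : ℝ) (m : Fin d → ℤ) : EuclideanSpace ℝ (Fin d) :=
  WithLp.toLp 2 fun i => t * (m i : ℝ)

lemma latticePoint_apply {d : ℕ} (t : ℝ) (m : Fin d → ℤ) (i : Fin d) :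
    latticePoint t m i = t * (m i : ℝ) := rfl

lemma measurable_floorVec {d : ℕ} : Measurable (floorVec (d := d)) := by
  refine measurable_pi_lambda _ fun i => Int.measurable_floor.comp ?_
  fun_prop

/-- Unit cells have volume one, so sums over `ℤᵈ` are integrals of step functions. -/
lemma map_floorVec_volume (d : ℕ) :
    (volume : Measure (EuclideanSpace ℝ (Fin d))).map floorVec = Measure.count := by
  refine Measure.ext_of_singleton fun m => ?_
  rw [Measure.map_apply measurable_floorVec (measurableSet_singleton m), Measure.count_singleton]
  have hset : (floorVec ⁻¹' {m} : Set (EuclideanSpace ℝ (Fin d)))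
      = (@WithLp.ofLp 2 (Fin d → ℝ)) ⁻¹'
        (Set.univ.pi fun i => Set.Ico (m i : ℝ) (m i + 1)) := by
    ext x
    simp only [Set.mem_preimage, Set.mem_singleton_iff, Set.mem_pi, Set.mem_univ, true_imp_iff,
      Set.mem_Ico, funext_iff, floorVec, Int.floor_eq_iff]
  rw [hset, (PiLp.volume_preserving_ofLp (Fin d)).measure_preimage
    (MeasurableSet.univ_pi fun i => measurableSet_Ico).nullMeasurableSet, Real.volume_pi_Ico]
  simp

lemma lintegral_comp_smul {d : ℕ} {r : ℝ} (hr : 0 < r) (f : EuclideanSpace ℝ (Fin d) → ENNReal) :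
    ∫⁻ x, f (r • x) = ENNReal.ofReal ((r ^ d)⁻¹) * ∫⁻ x, f x := by
  have hm : MeasurableEmbedding fun x : EuclideanSpace ℝ (Fin d) => r • x :=
    (Homeomorph.smulOfNeZero r hr.ne').measurableEmbedding
  rw [← hm.lintegral_map, Measure.map_addHaar_smul volume hr.ne', lintegral_smul_measure,
    finrank_euclideanSpace_fin, abs_of_pos (by positivity), smul_eq_mul]

lemma tsum_div_volume {d : ℕ} {L : ℝ} (hL : 0 < L) (g : (Fin d → ℤ) → ENNReal) :
    (∑' m, g m) / ENNReal.ofReal (L ^ d) = ENNReal.ofReal (((2 * Real.pi) ^ d)⁻¹) *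
      ∫⁻ z : EuclideanSpace ℝ (Fin d), g (floorVec ((2 * Real.pi / L)⁻¹ • z)) := by
  have hp := Real.pi_pos
  rw [lintegral_comp_smul (by positivity) fun z => g (floorVec z), ← mul_assoc,
    ← ENNReal.ofReal_mul (by positivity), ← lintegral_map (measurable_of_countable g)
    measurable_floorVec, map_floorVec_volume, lintegral_count, mul_comm, ENNReal.div_eq_inv_mul,
    mul_comm]
  congr 1
  rw [← ENNReal.ofReal_inv_of_pos (by positivity)]
  congr 1
  rw [inv_pow, div_pow]
  field_simp

lemma norm_le_sqrt_mul {d : ℕ} (x : EuclideanSpace ℝ (Fin d)) {c : ℝ} (hc : 0 ≤ c)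
    (h : ∀ i, |x i| ≤ c) : ‖x‖ ≤ √d * c := by
  rw [EuclideanSpace.norm_eq]
  refine Real.sqrt_le_iff.mpr ⟨by positivity, ?_⟩
  rw [mul_pow, Real.sq_sqrt (Nat.cast_nonneg d)]
  refine (Finset.sum_le_card_nsmul Finset.univ _ (c ^ 2) fun i _ => ?_).trans_eq (by simp)
  rw [Real.norm_eq_abs]
  exact pow_le_pow_left₀ (abs_nonneg _) (h i) 2

lemma norm_sub_latticePoint_le {d : ℕ} {t : ℝ} (ht : 0 < t) (z : EuclideanSpace ℝ (Fin d)) :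
    ‖z - latticePoint t (floorVec (t⁻¹ • z))‖ ≤ √d * t := by
  refine norm_le_sqrt_mul _ ht.le fun i => ?_
  have e : (z - latticePoint t (floorVec (t⁻¹ • z))) i = t * Int.fract (t⁻¹ * z i) := by
    rw [PiLp.sub_apply, latticePoint_apply]
    unfold Int.fract
    rw [mul_sub, mul_inv_cancel_left₀ ht.ne']
    rfl
  rw [e, abs_of_nonneg (mul_nonneg ht.le (Int.fract_nonneg _))]
  exact mul_le_of_le_one_right ht.le (Int.fract_lt_one _).le

lemma le_norm_latticePoint {d : ℕ} {t : ℝ} (ht : 0 < t) {m : Fin d → ℤ} (hm : m ≠ 0) :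
    t ≤ ‖latticePoint t m‖ := by
  obtain ⟨i, hi⟩ : ∃ i, m i ≠ 0 := by
    by_contra! h
    exact hm (funext h)
  refine le_trans ?_ (PiLp.norm_apply_le (latticePoint t m) i)
  rw [latticePoint_apply, norm_mul, Real.norm_of_nonneg ht.le]
  refine le_mul_of_one_le_right ht.le ?_
  rw [Real.norm_eq_abs, ← Int.cast_abs]
  exact_mod_cast Int.one_le_abs hi

/-- The lattice point is within `√d t` of `z` and, being nonzero, has norm at least `t`. The
constant `1 + √d` does not depend on `t`, so dilating the Bose function by it gives one majorant for
all box sizes. -/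
lemma norm_le_mul_norm_latticePoint {d : ℕ} {t : ℝ} (ht : 0 < t) (z : EuclideanSpace ℝ (Fin d))
    (hm : floorVec (t⁻¹ • z) ≠ 0) :
    ‖z‖ ≤ (1 + √d) * ‖latticePoint t (floorVec (t⁻¹ • z))‖ := by
  have h1 := norm_sub_latticePoint_le ht z
  have h2 := le_norm_latticePoint ht hm
  have h3 := norm_sub_norm_le z (latticePoint t (floorVec (t⁻¹ • z)))
  have h4 := mul_le_mul_of_nonneg_left h2 (Real.sqrt_nonneg d)
  linarith

/-- The Bose distribution on the lattice `t ℤᵈ` without the origin. -/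
noncomputable def latticeBose (d : ℕ) (β s y t : ℝ) (m : Fin d → ℤ) : ENNReal :=
  if m = 0 then 0 else ENNReal.ofReal (bose β s y ‖latticePoint t m‖)

lemma latticeBose_floorVec_le {d : ℕ} {β s y y₀ t : ℝ} (hβ : 0 < β) (hs : 0 < s) (hy₀ : 1 ≤ y₀)
    (hy : y₀ ≤ y) (ht : 0 < t) {z : EuclideanSpace ℝ (Fin d)} (hz : 0 < ‖z‖) :
    latticeBose d β s y t (floorVec (t⁻¹ • z))
      ≤ ENNReal.ofReal (bose β s y₀ ‖(1 + √d)⁻¹ • z‖) := by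
  unfold latticeBose
  split_ifs with hm
  · exact zero_le
  · have hK : 0 < 1 + √d := by positivity
    have h1 : 0 < ‖(1 + √d)⁻¹ • z‖ := by
      rw [norm_smul, Real.norm_of_nonneg (by positivity)]
      positivity
    have h2 : ‖(1 + √d)⁻¹ • z‖ ≤ ‖latticePoint t (floorVec (t⁻¹ • z))‖ := by
      rw [norm_smul, Real.norm_of_nonneg (by positivity), inv_mul_le_iff₀ hK]
      exact norm_le_mul_norm_latticePoint ht z hm
    refine ENNReal.ofReal_le_ofReal ?_
    exact (bose_anti_left hβ hy₀ hy (norm_nonneg _) (Or.inr (h1.trans_le h2))).trans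
      (bose_anti_right hβ hs hy₀ h1.le h2 (Or.inr h1))

lemma lintegral_bose_smul_ne_top {d : ℕ} {β s y : ℝ} (h : idealDensity d s β y ≠ ⊤) :
    ∫⁻ z : EuclideanSpace ℝ (Fin d), ENNReal.ofReal (bose β s y ‖(1 + √d)⁻¹ • z‖) ≠ ⊤ := by
  rw [lintegral_comp_smul (by positivity) fun z => ENNReal.ofReal (bose β s y ‖z‖)]
  exact ENNReal.mul_ne_top ENNReal.ofReal_ne_top (idealDensity_ne_top_iff.mp h)

lemma tsum_latticeBose_ne_top {d : ℕ} (hd : 1 ≤ d) {β s y L : ℝ} (hβ : 0 < β) (hs : 0 < s)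
    (hy : 1 < y) (hL : 0 < L) : ∑' m, latticeBose d β s y (2 * Real.pi / L) m ≠ ⊤ := by
  have hp := Real.pi_pos
  have h := tsum_div_volume hL (latticeBose d β s y (2 * Real.pi / L))
  have h2 : ENNReal.ofReal (((2 * Real.pi) ^ d)⁻¹) * ∫⁻ z : EuclideanSpace ℝ (Fin d),
      latticeBose d β s y (2 * Real.pi / L) (floorVec ((2 * Real.pi / L)⁻¹ • z)) ≠ ⊤ := by
    refine ENNReal.mul_ne_top ENNReal.ofReal_ne_top (ne_top_of_le_ne_top
      (lintegral_bose_smul_ne_top (idealDensity_ne_top hd hs hβ hy)) (lintegral_mono_ae ?_))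
    filter_upwards [ae_norm_pos hd] with z hz
    exact latticeBose_floorVec_le hβ hs hy.le le_rfl (by positivity) hz
  rw [← h] at h2
  intro h3
  rw [h3, ENNReal.top_div_of_ne_top ENNReal.ofReal_ne_top] at h2
  exact h2 rfl

/-- The density of the modes other than the zero mode converges in the thermodynamic limit. -/
lemma tendsto_latticeBose_div_volume {d : ℕ} (hd : 1 ≤ d) {β s y y₀ : ℝ} (hβ : 0 < β)
    (hs : 0 < s) (hy₀ : 1 ≤ y₀) (hfin : idealDensity d s β y₀ ≠ ⊤) {Y : ℝ → ℝ}
    (hY₀ : ∀ᶠ L in atTop, y₀ ≤ Y L) (hY : Tendsto Y atTop (𝓝 y)) :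
    Tendsto (fun L : ℝ => (∑' m, latticeBose d β s (Y L) (2 * Real.pi / L) m)
      / ENNReal.ofReal (L ^ d)) atTop (𝓝 (idealDensity d s β y)) := by
  have hp := Real.pi_pos
  have hy : 1 ≤ y := hy₀.trans (ge_of_tendsto hY hY₀)
  have ht : Tendsto (fun L : ℝ => 2 * Real.pi / L) atTop (𝓝 0) :=
    tendsto_const_nhds.div_atTop tendsto_id
  have key : Tendsto (fun L : ℝ => ENNReal.ofReal (((2 * Real.pi) ^ d)⁻¹) *
      ∫⁻ z : EuclideanSpace ℝ (Fin d), latticeBose d β s (Y L) (2 * Real.pi / L)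
        (floorVec ((2 * Real.pi / L)⁻¹ • z))) atTop (𝓝 (idealDensity d s β y)) := by
    refine ENNReal.Tendsto.const_mul ?_ (Or.inr ENNReal.ofReal_ne_top)
    refine tendsto_lintegral_filter_of_dominated_convergence
      (fun z => ENNReal.ofReal (bose β s y₀ ‖(1 + √d)⁻¹ • z‖))
      (Eventually.of_forall fun L =>
        (measurable_of_countable (latticeBose d β s (Y L) (2 * Real.pi / L))).comp
          (measurable_floorVec.comp (measurable_const_smul (2 * Real.pi / L)⁻¹))) ?_
      (lintegral_bose_smul_ne_top hfin) ?_
    · filter_upwards [hY₀, eventually_gt_atTop 0] with L hL hL0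
      filter_upwards [ae_norm_pos hd] with z hz
      exact latticeBose_floorVec_le hβ hs hy₀ hL (by positivity) hz
    · filter_upwards [ae_norm_pos hd] with z hz
      have hlim : Tendsto (fun L : ℝ => latticePoint (2 * Real.pi / L)
          (floorVec ((2 * Real.pi / L)⁻¹ • z))) atTop (𝓝 z) := by
        rw [tendsto_iff_norm_sub_tendsto_zero]
        have h0 : Tendsto (fun L : ℝ => √d * (2 * Real.pi / L)) atTop (𝓝 0) := by
          simpa using ht.const_mul (√d)
        refine squeeze_zero' (Eventually.of_forall fun L => norm_nonneg _) ?_ h0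
        filter_upwards [eventually_gt_atTop 0] with L hL
        rw [norm_sub_rev]
        exact norm_sub_latticePoint_le (by positivity) z
      -- The step function is set to zero on the cell labelled `0`; a fixed `z ≠ 0` eventually
      -- leaves that cell.
      have hev : ∀ᶠ L : ℝ in atTop, floorVec ((2 * Real.pi / L)⁻¹ • z) ≠ 0 := by
        filter_upwards [hlim.norm.eventually_const_lt hz] with L hL h0
        rw [h0] at hL
        have : latticePoint (d := d) (2 * Real.pi / L) 0 = 0 := by
          ext i
          simp [latticePoint_apply]
        simp [this] at hL
      refine (ENNReal.tendsto_ofReal (tendsto_bose hβ hs hy hz.le (Or.inr hz) hY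
        hlim.norm)).congr' ?_
      filter_upwards [hev] with L hL
      rw [latticeBose, if_neg hL]
  refine key.congr' ?_
  filter_upwards [eventually_gt_atTop 0] with L hL
  exact (tsum_div_volume hL _).symm

/-! ### Solving for the density -/

/-- Near `y₀` the value `j y` lies between `y₀ j(y₀)/y` and `(y₀-1) j(y₀)/(y-1)`, both continuous
with value `j y₀` at `y₀`. -/
lemma continuousOn_of_mul_monotone {j : ℝ → ℝ}
    (h1 : ∀ y' y, 1 < y' → y' ≤ y → y * j y ≤ y' * j y')
    (h2 : ∀ y' y, 1 < y' → y' ≤ y → (y' - 1) * j y' ≤ (y - 1) * j y) :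
    ContinuousOn j (Set.Ioi 1) := by
  intro y₀ hy₀
  rw [Set.mem_Ioi] at hy₀
  refine ContinuousAt.continuousWithinAt ?_
  have hA : ContinuousAt (fun y => y₀ * j y₀ / y) y₀ :=
    continuousAt_const.div continuousAt_id (by linarith)
  have hB : ContinuousAt (fun y => (y₀ - 1) * j y₀ / (y - 1)) y₀ :=
    continuousAt_const.div (continuousAt_id.sub continuousAt_const) (by simp; linarith)
  have eA : y₀ * j y₀ / y₀ = j y₀ := by field_simp
  have eB : (y₀ - 1) * j y₀ / (y₀ - 1) = j y₀ := by
    have : y₀ - 1 ≠ 0 := by linarith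
    field_simp
  have hmin := hA.min hB
  have hmax := hA.max hB
  unfold ContinuousAt at hmin hmax ⊢
  simp only [eA, eB, min_self, max_self] at hmin hmax
  refine tendsto_of_tendsto_of_tendsto_of_le_of_le' hmin hmax ?_ ?_
  · filter_upwards [eventually_gt_nhds hy₀] with y hy
    rcases le_total y y₀ with h | h
    · refine (min_le_left _ _).trans ?_
      rw [div_le_iff₀ (by linarith), mul_comm (j y)]
      exact h1 y y₀ hy h
    · refine (min_le_right _ _).trans ?_
      rw [div_le_iff₀ (by linarith), mul_comm (j y)]
      exact h2 y₀ y hy₀ h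
  · filter_upwards [eventually_gt_nhds hy₀] with y hy
    rcases le_total y y₀ with h | h
    · refine le_trans ?_ (le_max_right _ _)
      rw [le_div_iff₀ (by linarith), mul_comm (j y)]
      exact h2 y y₀ hy h
    · refine le_trans ?_ (le_max_left _ _)
      rw [le_div_iff₀ (by linarith), mul_comm (j y)]
      exact h1 y₀ y hy₀ h

lemma existsUnique_of_mul_monotone {j : ℝ → ℝ}
    (h1 : ∀ y' y, 1 < y' → y' ≤ y → y * j y ≤ y' * j y')
    (h2 : ∀ y' y, 1 < y' → y' ≤ y → (y' - 1) * j y' ≤ (y - 1) * j y)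
    {ρ y₁ : ℝ} (hρ : 0 < ρ) (hy₁ : 1 < y₁) (hj : ρ ≤ j y₁) : ∃! y, 1 < y ∧ j y = ρ := by
  -- The right end of the interval for the intermediate value theorem is the point where
  -- monotonicity of `y j(y)` forces `j ≤ ρ`.
  have hle : y₁ ≤ y₁ * j y₁ / ρ := by
    rw [le_div_iff₀ hρ]
    exact mul_le_mul_of_nonneg_left hj (by linarith)
  have h3 : j (y₁ * j y₁ / ρ) ≤ ρ := by
    have h := h1 y₁ _ hy₁ hle
    have hp : 0 < y₁ * j y₁ := mul_pos (by linarith) (hρ.trans_le hj)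
    rw [div_mul_eq_mul_div, div_le_iff₀ hρ] at h
    exact le_of_mul_le_mul_left h hp
  have hc : ContinuousOn j (Set.Icc y₁ (y₁ * j y₁ / ρ)) :=
    (continuousOn_of_mul_monotone h1 h2).mono fun y hy => hy₁.trans_le hy.1
  obtain ⟨y, hy, hjy⟩ := intermediate_value_Icc' hle hc ⟨h3, hj⟩
  refine ⟨y, ⟨hy₁.trans_le hy.1, hjy⟩, ?_⟩
  have huniq : ∀ a b, 1 < a → j a = ρ → j b = ρ → a ≤ b → a = b := by
    intro a b ha hja hjb hab
    have h := h1 a b ha hab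
    rw [hja, hjb] at h
    exact le_antisymm hab (le_of_mul_le_mul_right h hρ)
  rintro y' ⟨hy', hjy'⟩
  rcases le_total y' y with h | h
  · exact huniq y' y hy' hjy' hjy h
  · exact (huniq y y' (hy₁.trans_le hy.1) hjy hjy' h).symm

/-! ### The density in the box as a function of `y`. -/

section Density

variable {d : ℕ} {s β : ℝ}

lemma density_eq_tsum_bose (L y : ℝ) : density d s β L y
    = (∑' m : Fin d → ℤ, bose β s y ‖latticePoint (2 * Real.pi / L) m‖) / L ^ d := rfl

lemma bose_zero (hs : 0 < s) (y : ℝ) : bose β s y 0 = 1 / (y - 1) := by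
  simp [bose, Real.zero_rpow hs.ne']

lemma latticePoint_zero (t : ℝ) : latticePoint (d := d) t 0 = 0 := by
  ext i
  simp [latticePoint_apply]

lemma hasSum_bose (hd : 1 ≤ d) (hs : 0 < s) (hβ : 0 < β) {L y : ℝ} (hL : 0 < L) (hy : 1 < y) :
    HasSum (fun m : Fin d → ℤ => bose β s y ‖latticePoint (2 * Real.pi / L) m‖)
      (1 / (y - 1) + (∑' m : Fin d → ℤ, latticeBose d β s y (2 * Real.pi / L) m).toReal) := by
  have hfin := tsum_latticeBose_ne_top hd hβ hs hy hL
  have h1 : HasSum (fun m => (latticeBose d β s y (2 * Real.pi / L) m).toReal)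
      (∑' m : Fin d → ℤ, latticeBose d β s y (2 * Real.pi / L) m).toReal := by
    rw [ENNReal.tsum_toReal_eq (ENNReal.ne_top_of_tsum_ne_top hfin)]
    exact (ENNReal.summable_toReal hfin).hasSum
  refine HasSum.congr_fun ((hasSum_pi_single (0 : Fin d → ℤ) (1 / (y - 1))).add h1) fun m => ?_
  by_cases hm : m = 0
  · subst hm
    simp [latticeBose, latticePoint_zero, bose_zero hs]
  · rw [Pi.single_eq_of_ne hm, latticeBose, if_neg hm, zero_add,
      ENNReal.toReal_ofReal (bose_nonneg hβ hy.le (norm_nonneg _) s)]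

lemma density_eq_add (hd : 1 ≤ d) (hs : 0 < s) (hβ : 0 < β) {L y : ℝ} (hL : 0 < L)
    (hy : 1 < y) : density d s β L y = 1 / (y - 1) / L ^ d +
      ((∑' m : Fin d → ℤ, latticeBose d β s y (2 * Real.pi / L) m)
        / ENNReal.ofReal (L ^ d)).toReal := by
  rw [density_eq_tsum_bose, (hasSum_bose hd hs hβ hL hy).tsum_eq, add_div, ENNReal.toReal_div,
    ENNReal.toReal_ofReal (by positivity)]

lemma mul_density_le (hd : 1 ≤ d) (hs : 0 < s) (hβ : 0 < β) {L : ℝ} (hL : 0 < L)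
    (y' y : ℝ) (hy' : 1 < y') (hy : y' ≤ y) :
    y * density d s β L y ≤ y' * density d s β L y' := by
  have h1 := (hasSum_bose hd hs hβ hL hy').mul_left y'
  have h2 := (hasSum_bose hd hs hβ hL (hy'.trans_le hy)).mul_left y
  rw [density_eq_tsum_bose, density_eq_tsum_bose, ← mul_div_assoc, ← mul_div_assoc]
  refine div_le_div_of_nonneg_right ?_ (by positivity)
  rw [← tsum_mul_left, ← tsum_mul_left]
  exact h2.summable.tsum_le_tsum
    (fun m => mul_bose_le hβ hy'.le hy (norm_nonneg _) (Or.inl hy')) h1.summable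

lemma sub_one_mul_density_le (hd : 1 ≤ d) (hs : 0 < s) (hβ : 0 < β) {L : ℝ} (hL : 0 < L)
    (y' y : ℝ) (hy' : 1 < y') (hy : y' ≤ y) :
    (y' - 1) * density d s β L y' ≤ (y - 1) * density d s β L y := by
  have h1 := (hasSum_bose hd hs hβ hL hy').mul_left (y' - 1)
  have h2 := (hasSum_bose hd hs hβ hL (hy'.trans_le hy)).mul_left (y - 1)
  rw [density_eq_tsum_bose, density_eq_tsum_bose, ← mul_div_assoc, ← mul_div_assoc]
  refine div_le_div_of_nonneg_right ?_ (by positivity)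
  rw [← tsum_mul_left, ← tsum_mul_left]
  exact h1.summable.tsum_le_tsum
    (fun m => sub_one_mul_bose_le hβ hy' hy (norm_nonneg _)) h2.summable

lemma existsUnique_density (hd : 1 ≤ d) (hs : 0 < s) (hβ : 0 < β) {ρ L : ℝ} (hρ : 0 < ρ)
    (hL : 0 < L) : ∃! y : ℝ, 1 < y ∧ density d s β L y = ρ := by
  have hV : 0 < L ^ d := pow_pos hL d
  -- At this `y` the zero mode alone already has density `ρ`.
  have hy₁ : 1 < 1 + 1 / (ρ * L ^ d) := by
    have : 0 < 1 / (ρ * L ^ d) := by positivity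
    linarith
  refine existsUnique_of_mul_monotone (mul_density_le hd hs hβ hL)
    (sub_one_mul_density_le hd hs hβ hL) hρ hy₁ ?_
  rw [density_eq_add hd hs hβ hL hy₁]
  have e : 1 / (1 + 1 / (ρ * L ^ d) - 1) / L ^ d = ρ := by
    rw [add_sub_cancel_left, one_div_one_div]
    field_simp
  rw [e]
  exact le_add_of_nonneg_right ENNReal.toReal_nonneg

lemma yBox_spec (hd : 1 ≤ d) (hs : 0 < s) (hβ : 0 < β) {ρ L : ℝ} (hρ : 0 < ρ) (hL : 0 < L) :
    1 < yBox d s β ρ L ∧ density d s β L (yBox d s β ρ L) = ρ := by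
  obtain ⟨y, ⟨hy, hyρ⟩, -⟩ := existsUnique_density hd hs hβ hρ hL
  have h : ∃ a ∈ Set.Ioi (1 : ℝ), density d s β L a = ρ := ⟨y, hy, hyρ⟩
  exact ⟨Function.invFunOn_mem h, Function.invFunOn_eq h⟩

lemma lt_yBox (hd : 1 ≤ d) (hs : 0 < s) (hβ : 0 < β) {ρ L y : ℝ} (hρ : 0 < ρ) (hL : 0 < L)
    (hy : 1 < y) (h : ρ < density d s β L y) : y < yBox d s β ρ L := by
  obtain ⟨h1, h2⟩ := yBox_spec hd hs hβ hρ hL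
  by_contra! hle
  have h3 := mul_density_le hd hs hβ hL _ _ h1 hle
  rw [h2] at h3
  nlinarith

lemma yBox_lt (hd : 1 ≤ d) (hs : 0 < s) (hβ : 0 < β) {ρ L y : ℝ} (hρ : 0 < ρ) (hL : 0 < L)
    (hy : 1 < y) (h : density d s β L y < ρ) : yBox d s β ρ L < y := by
  obtain ⟨h1, h2⟩ := yBox_spec hd hs hβ hρ hL
  by_contra! hle
  have h3 := mul_density_le hd hs hβ hL _ _ hy hle
  rw [h2] at h3
  nlinarith

/-! ### Thermodynamic limits of `y` and of the zero mode. -/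

lemma tendsto_pow_atTop_of_one_le (hd : 1 ≤ d) : Tendsto (fun L : ℝ => L ^ d) atTop atTop :=
  tendsto_pow_atTop (by omega)

/-- The thermodynamic limit of the density at fixed `y > 1`. -/
lemma tendsto_density (hd : 1 ≤ d) (hs : 0 < s) (hβ : 0 < β) {y : ℝ} (hy : 1 < y) :
    Tendsto (fun L => density d s β L y) atTop (𝓝 (idealDensity d s β y).toReal) := by
  have hfin := idealDensity_ne_top hd hs hβ hy
  have h1 := tendsto_latticeBose_div_volume hd hβ hs hy.le hfin (Y := fun _ => y)
    (Eventually.of_forall fun _ => le_rfl) tendsto_const_nhds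
  have h2 := (ENNReal.tendsto_toReal hfin).comp h1
  have h3 : Tendsto (fun L : ℝ => 1 / (y - 1) / L ^ d) atTop (𝓝 0) :=
    tendsto_const_nhds.div_atTop (tendsto_pow_atTop_of_one_le hd)
  have h4 := h3.add h2
  rw [zero_add] at h4
  refine h4.congr' ?_
  filter_upwards [eventually_gt_atTop 0] with L hL
  exact (density_eq_add hd hs hβ hL hy).symm

lemma mul_toReal_idealDensity_le (hd : 1 ≤ d) (hs : 0 < s) (hβ : 0 < β)
    (y' y : ℝ) (hy' : 1 < y') (hy : y' ≤ y) :
    y * (idealDensity d s β y).toReal ≤ y' * (idealDensity d s β y').toReal := by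
  have h := mul_idealDensity_le hd (s := s) hβ hy'.le hy
  have h' := ENNReal.toReal_mono
    (ENNReal.mul_ne_top ENNReal.ofReal_ne_top (idealDensity_ne_top hd hs hβ hy')) h
  rwa [ENNReal.toReal_mul, ENNReal.toReal_mul, ENNReal.toReal_ofReal (by linarith),
    ENNReal.toReal_ofReal (by linarith)] at h'

lemma sub_one_mul_toReal_idealDensity_le (hd : 1 ≤ d) (hs : 0 < s) (hβ : 0 < β)
    (y' y : ℝ) (hy' : 1 < y') (hy : y' ≤ y) :
    (y' - 1) * (idealDensity d s β y').toReal ≤ (y - 1) * (idealDensity d s β y).toReal := by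
  have h := sub_one_mul_idealDensity_le (d := d) (s := s) hβ hy' hy
  have h' := ENNReal.toReal_mono
    (ENNReal.mul_ne_top ENNReal.ofReal_ne_top (idealDensity_ne_top hd hs hβ (hy'.trans_le hy))) h
  rwa [ENNReal.toReal_mul, ENNReal.toReal_mul, ENNReal.toReal_ofReal (by linarith),
    ENNReal.toReal_ofReal (by linarith)] at h'

/-- Below the critical density `y` stays away from `1`. -/
lemma exists_tendsto_yBox_of_lt (hd : 1 ≤ d) (hs : 0 < s) (hβ : 0 < β) {ρ : ℝ} (hρ : 0 < ρ)
    (h : ENNReal.ofReal ρ < criticalDensity d s β) :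
    ∃ y, 1 < y ∧ Tendsto (yBox d s β ρ) atTop (𝓝 y) := by
  rw [criticalDensity_eq] at h
  obtain ⟨n, hn⟩ := ((tendsto_idealDensity_one hd hs hβ).eventually_const_lt h).exists
  have hy₁ : 1 < 1 + 1 / ((n : ℝ) + 1) := by
    have : 0 < 1 / ((n : ℝ) + 1) := by positivity
    linarith
  have hmul := mul_toReal_idealDensity_le (d := d) hd hs hβ
  obtain ⟨y, ⟨hy, hyρ⟩, -⟩ := existsUnique_of_mul_monotone hmul
    (sub_one_mul_toReal_idealDensity_le hd hs hβ) hρ hy₁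
    ((ENNReal.ofReal_le_iff_le_toReal (idealDensity_ne_top hd hs hβ hy₁)).mp hn.le)
  refine ⟨y, hy, tendsto_order.mpr ⟨fun a ha => ?_, fun a ha => ?_⟩⟩
  -- The test point `a` may lie below `1`, where the density limit is not available; it is raised to
  -- a point of `(1, y)`.
  · have hb : 1 < max a ((1 + y) / 2) := lt_max_of_lt_right (by linarith)
    have hb' : max a ((1 + y) / 2) < y := max_lt ha (by linarith)
    set b := max a ((1 + y) / 2)
    have h1 := hmul b y hb hb'.le
    rw [hyρ] at h1
    have h2 : ρ < (idealDensity d s β b).toReal := by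
      by_contra! hle
      nlinarith
    filter_upwards [(tendsto_density hd hs hβ hb).eventually_const_lt h2,
      eventually_gt_atTop 0] with L h3 hL
    exact (le_max_left _ _).trans_lt (lt_yBox hd hs hβ hρ hL hb h3)
  · have ha1 : 1 < a := hy.trans ha
    have h1 := hmul y a hy ha.le
    rw [hyρ] at h1
    have h2 : (idealDensity d s β a).toReal < ρ := by
      by_contra! hle
      nlinarith
    filter_upwards [(tendsto_density hd hs hβ ha1).eventually_lt_const h2,
      eventually_gt_atTop 0] with L h3 hL
    exact yBox_lt hd hs hβ hρ hL ha1 h3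

/-- At and above the critical density `y` tends to `1`. -/
lemma tendsto_yBox_of_ge (hd : 1 ≤ d) (hs : 0 < s) (hβ : 0 < β) {ρ : ℝ} (hρ : 0 < ρ)
    (h : criticalDensity d s β ≤ ENNReal.ofReal ρ) :
    Tendsto (yBox d s β ρ) atTop (𝓝 1) := by
  rw [criticalDensity_eq] at h
  refine tendsto_order.mpr ⟨fun a ha => ?_, fun a ha => ?_⟩
  · filter_upwards [eventually_gt_atTop 0] with L hL
    exact ha.trans (yBox_spec hd hs hβ hρ hL).1
  · have h1 := mul_idealDensity_le hd (s := s) hβ le_rfl ha.le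
    rw [ENNReal.ofReal_one, one_mul] at h1
    have h2 := ENNReal.toReal_mono ENNReal.ofReal_ne_top (h1.trans h)
    rw [ENNReal.toReal_mul, ENNReal.toReal_ofReal (by linarith),
      ENNReal.toReal_ofReal hρ.le] at h2
    -- Strict even at criticality: `a` times this density is at most `ρ`, and `a > 1`.
    have h3 : (idealDensity d s β a).toReal < ρ := by
      by_contra! hle
      nlinarith
    filter_upwards [(tendsto_density hd hs hβ ha).eventually_lt_const h3,
      eventually_gt_atTop 0] with L h3 hL
    exact yBox_lt hd hs hβ hρ hL ha h3

/-- The total density is fixed at `ρ` and the nonzero modes saturate at `ρ_c`, so the zero mode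
takes the rest. Finiteness of `ρ_c` allows domination by the Bose function at `y₀ = 1`. -/
lemma tendsto_zeroModeDensity_of_ge (hd : 1 ≤ d) (hs : 0 < s) (hβ : 0 < β) {ρ : ℝ}
    (hρ : 0 < ρ) (h : criticalDensity d s β ≤ ENNReal.ofReal ρ) :
    Tendsto (zeroModeDensity d s β ρ) atTop (𝓝 (ρ - (criticalDensity d s β).toReal)) := by
  have hY := tendsto_yBox_of_ge hd hs hβ hρ h
  rw [criticalDensity_eq] at h ⊢
  have hfin : idealDensity d s β 1 ≠ ⊤ := ne_top_of_le_ne_top ENNReal.ofReal_ne_top h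
  have h1 := tendsto_latticeBose_div_volume hd hβ hs le_rfl hfin (Y := yBox d s β ρ)
    (by filter_upwards [eventually_gt_atTop 0] with L hL
        exact (yBox_spec hd hs hβ hρ hL).1.le) hY
  have h2 := ((ENNReal.tendsto_toReal hfin).comp h1).const_sub ρ
  refine h2.congr' ?_
  filter_upwards [eventually_gt_atTop 0] with L hL
  obtain ⟨hy, hyρ⟩ := yBox_spec hd hs hβ hρ hL
  rw [density_eq_add hd hs hβ hL hy] at hyρ
  simp only [Function.comp_apply, zeroModeDensity]
  linarith

/-! ### The order parameters in the limit. -/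

lemma tendsto_boxOrder_iff (hd : 1 ≤ d) (hs : 0 < s) (hβ : 0 < β) {ρ : ℝ} (hρ : 0 < ρ)
    (a o : ℝ) : IsOrderParameter d s β ρ a o ↔ Tendsto (fun L : ℝ => gaussianLorentz
      ((L ^ d) ^ (-a) * (1 / 2 + 1 / (yBox d s β ρ L - 1)))) atTop (𝓝 o) := by
  have h : boxOrder d s β ρ a =ᶠ[atTop] fun L : ℝ => ((gaussianLorentz
      ((L ^ d) ^ (-a) * (1 / 2 + 1 / (yBox d s β ρ L - 1))) : ℝ) : ℂ) := by
    filter_upwards [eventually_gt_atTop 0] with L hL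
    have hy := (yBox_spec hd hs hβ hρ hL).1
    exact boxOrder_eq hs hβ hL hy (hasSum_bose hd hs hβ hL hy).summable a
  unfold IsOrderParameter
  rw [tendsto_congr' h]
  refine ⟨fun h => ?_, fun h => (Complex.continuous_ofReal.tendsto _).comp h⟩
  exact (Complex.continuous_re.tendsto _).comp h

/-- The order parameter for the functions normalized in `L¹` is a function of the condensate
density. -/
lemma isOrderParameter_one (hd : 1 ≤ d) (hs : 0 < s) (hβ : 0 < β) {ρ ρ₀ : ℝ} (hρ : 0 < ρ)
    (hρ₀ : 0 ≤ ρ₀) (h : IsCondensateDensity d s β ρ ρ₀) :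
    IsOrderParameter d s β ρ 1 (gaussianLorentz ρ₀) := by
  rw [tendsto_boxOrder_iff hd hs hβ hρ]
  have hV := tendsto_pow_atTop_of_one_le hd
  have h1 : Tendsto (fun L : ℝ => 1 / 2 / L ^ d) atTop (𝓝 0) := tendsto_const_nhds.div_atTop hV
  have h2 := h1.add h
  rw [zero_add] at h2
  have he : (fun L : ℝ => 1 / 2 / L ^ d + zeroModeDensity d s β ρ L) =ᶠ[atTop]
      fun L : ℝ => (L ^ d) ^ (-1 : ℝ) * (1 / 2 + 1 / (yBox d s β ρ L - 1)) := by
    filter_upwards with L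
    rw [Real.rpow_neg_one, zeroModeDensity, ← add_div, div_eq_inv_mul]
  refine tendsto_gaussianLorentz ?_ hρ₀ (h2.congr' he)
  filter_upwards [eventually_gt_atTop 0] with L hL
  have hy := (yBox_spec hd hs hβ hρ hL).1
  have : 0 < 1 / (yBox d s β ρ L - 1) := one_div_pos.mpr (by linarith)
  positivity

end Density

end FreeBose


/-! ### Conclusion, below the critical density and at or above it. -/

theorem mainTheorem2 (d : ℕ) (hd : 1 ≤ d) (s β ρ : ℝ) (hs : 0 < s) (hβ : 0 < β) (hρ : 0 < ρ) :
    (∀ L : ℝ, 0 < L → ∃! y : ℝ, 1 < y ∧ FreeBose.density d s β L y = ρ) ∧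
    ∃ ρ₀ o₀ o₁ : ℝ,
      FreeBose.IsCondensateDensity d s β ρ ρ₀ ∧
      FreeBose.IsOrderParameter d s β ρ 0 o₀ ∧ o₀ ∈ Set.Icc (0 : ℝ) 1 ∧
      FreeBose.IsOrderParameter d s β ρ 1 o₁ ∧ o₁ ∈ Set.Icc (0 : ℝ) 1 ∧
      (0 < ρ₀ ↔ o₁ < 1) ∧
      (ENNReal.ofReal ρ ≠ FreeBose.criticalDensity d s β → (0 < ρ₀ ↔ o₀ = 0)) := by
  refine ⟨fun L hL => FreeBose.existsUnique_density hd hs hβ hρ hL, ?_⟩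
  have key : ∀ ρ₀ : ℝ, 0 ≤ ρ₀ → (0 < ρ₀ ↔ FreeBose.gaussianLorentz ρ₀ < 1) := by
    intro ρ₀ h0
    refine ⟨FreeBose.gaussianLorentz_lt_one, fun h => h0.lt_of_ne' ?_⟩
    rintro rfl
    exact absurd FreeBose.gaussianLorentz_zero h.ne
  rcases lt_or_ge (ENNReal.ofReal ρ) (FreeBose.criticalDensity d s β) with h | h
  · obtain ⟨y, hy, hY⟩ := FreeBose.exists_tendsto_yBox_of_lt hd hs hβ hρ h
    have hlim : Tendsto (fun L => 1 / (FreeBose.yBox d s β ρ L - 1)) atTop (𝓝 (1 / (y - 1))) :=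
      tendsto_const_nhds.div (hY.sub_const 1) (by linarith)
    have hv : 0 ≤ 1 / 2 + 1 / (y - 1) := by
      have : 0 < 1 / (y - 1) := one_div_pos.mpr (by linarith)
      linarith
    have hc : FreeBose.IsCondensateDensity d s β ρ 0 :=
      hlim.div_atTop (FreeBose.tendsto_pow_atTop_of_one_le hd)
    refine ⟨0, FreeBose.gaussianLorentz (1 / 2 + 1 / (y - 1)), FreeBose.gaussianLorentz 0, hc, ?_,
      FreeBose.gaussianLorentz_mem_Icc hv, FreeBose.isOrderParameter_one hd hs hβ hρ le_rfl hc,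
      FreeBose.gaussianLorentz_mem_Icc le_rfl, key 0 le_rfl, fun _ => ?_⟩
    · rw [FreeBose.tendsto_boxOrder_iff hd hs hβ hρ]
      simp only [neg_zero, Real.rpow_zero, one_mul]
      refine FreeBose.tendsto_gaussianLorentz ?_ hv (hlim.const_add _)
      filter_upwards [eventually_gt_atTop 0] with L hL
      have hyL := (FreeBose.yBox_spec hd hs hβ hρ hL).1
      have : 0 < 1 / (FreeBose.yBox d s β ρ L - 1) := one_div_pos.mpr (by linarith)
      positivity
    · exact iff_of_false (lt_irrefl 0) (FreeBose.gaussianLorentz_pos hv).ne'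
  · have hY := FreeBose.tendsto_yBox_of_ge hd hs hβ hρ h
    have hc : FreeBose.IsCondensateDensity d s β ρ (ρ - (FreeBose.criticalDensity d s β).toReal) :=
      FreeBose.tendsto_zeroModeDensity_of_ge hd hs hβ hρ h
    have hfin := ne_top_of_le_ne_top ENNReal.ofReal_ne_top h
    have hle : (FreeBose.criticalDensity d s β).toReal ≤ ρ := ENNReal.toReal_le_of_le_ofReal hρ.le h
    have h0 : 0 ≤ ρ - (FreeBose.criticalDensity d s β).toReal := sub_nonneg.mpr hle
    -- The zero-mode occupation diverges also at `ρ = ρ_c`, where it is `o(V)`; hence `o₀ = 0` there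
    -- without condensation.
    have hinv : Tendsto (fun L => 1 / (FreeBose.yBox d s β ρ L - 1)) atTop atTop := by
      simp only [one_div]
      refine Tendsto.inv_tendsto_nhdsGT_zero (tendsto_nhdsWithin_iff.mpr ⟨?_, ?_⟩)
      · simpa using hY.sub_const 1
      · filter_upwards [eventually_gt_atTop 0] with L hL
        exact sub_pos.mpr (FreeBose.yBox_spec hd hs hβ hρ hL).1
    refine ⟨_, 0, _, hc, ?_, by simp, FreeBose.isOrderParameter_one hd hs hβ hρ h0 hc,
      FreeBose.gaussianLorentz_mem_Icc h0, key _ h0, fun hne => ?_⟩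
    · rw [FreeBose.tendsto_boxOrder_iff hd hs hβ hρ]
      simp only [neg_zero, Real.rpow_zero, one_mul]
      exact FreeBose.tendsto_gaussianLorentz_atTop (tendsto_atTop_add_const_left _ _ hinv)
    · simp only [iff_true]
      -- A vanishing condensate density would mean `ρ = ρ_c`, the excluded value.
      refine h0.lt_of_ne' fun he => hne ?_
      rw [sub_eq_zero] at he
      rw [he, ENNReal.ofReal_toReal hfin]
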